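/- (Backward uniqueness.) Let $m\ge 2$, let $M$ be a closed (compact, without boundary) connected smooth manifold of dimension $m+1$, and let $T>0$. Let $(g(t),p(t))$, $t\in[0,T)$, be a smooth solution of the conformal Ricci flow on $M$ with constant scalar curvature, that is, $g(t)$ is a family of Riemannian metrics and $p(t)=p(\cdot,t)$ a family of functions, smooth on $M\times[0,T)$, such that $R_{g(t)}\equiv -m(m+1)$ and $$\partial_t g=-2\big(\mathrm{Ric}+(m+p)g\big),\qquad (-\Delta_{g(t)}+(m+1))\,p=\tfrac1m\,|\mathrm{Ric}+mg|^2\qquad\text{on }M\times[0,T).$$ Let $f$ be a smooth function on $M\times[0,T)$ such that $H=(4\pi(T-t))^{-\frac{m+1}{2}}e^{-f}$ solves the conjugate heat equation $\partial_tH=-\Delta_{g(t)}H+(m+1)pH$ on $M\times[0,T)$, and let $\mathscr{R}ic_f=\mathrm{Ric}+\mathrm{Hess}\,f$. Let $h,k:[0,T)\to\mathbb{R}$ be smooth functions with $h(t)<0$ for all $t\in[0,T)$, and assume that $$\mathscr{R}ic_f\le\Big(\frac{k(t)}{2h(t)}+\frac{R_{g(t)}}{m+1}\Big)g(t)\qquad\text{on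 }M\times[0,T).$$ Put $\bar p(t)=\max_{x\in M}p(x,t)$, and let $v:M\times[0,T)\to\mathbb{R}$ be a classical solution of the linear heat equation $$\partial_tv-\Delta_{g(t)}v=\bar p(t)\,v\qquad\text{on }M\times[0,T),$$ where classical means that $v(\cdot,t)$ is of class $C^2$ for each $t$ and that $v$ and its first and second space derivatives in charts are continuous in $(x,t)$ on $M\times[0,T)$ (every smooth solution is classical). If $0<a<b<T$ and $v(\cdot,b)=0$, then $v(\cdot,t)=0$ for all $t\in[a,b)$. -/

import Mathlib

open Set
open scoped Manifold ContDiff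

noncomputable section

namespace ConformalRicci

/-- The coordinate space `ℝⁿ`. -/
abbrev Coord (n : ℕ) : Type := EuclideanSpace ℝ (Fin n)

/-! ### Coordinate expressions

`G` is the matrix-valued function `y ↦ (g_ij(y))` of components of a metric in a coordinate chart. -/

/-- The coordinate partial derivative `∂_i u`. -/
def partialDeriv {n : ℕ} (i : Fin n) (u : Coord n → ℝ) (y : Coord n) : ℝ :=
  fderiv ℝ u y (EuclideanSpace.single i 1)

/-- `Γ^k_ij = ½ g^{kl} (∂_i g_jl + ∂_j g_il - ∂_l g_ij)`. -/
def christoffel {n : ℕ} (G : Coord n → Matrix (Fin n) (Fin n) ℝ) (k i j : Fin n)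
    (y : Coord n) : ℝ :=
  (1 / 2) * ∑ l, (G y)⁻¹ k l *
    (partialDeriv i (fun z => G z j l) y + partialDeriv j (fun z => G z i l) y
      - partialDeriv l (fun z => G z i j) y)

/-- The Ricci tensor
`R_ij = ∂_a Γ^a_ij - ∂_i Γ^a_aj + Γ^a_ab Γ^b_ij - Γ^a_ib Γ^b_aj`
(positive on round spheres). -/
def ricci {n : ℕ} (G : Coord n → Matrix (Fin n) (Fin n) ℝ) (i j : Fin n) (y : Coord n) : ℝ :=
  ∑ a, partialDeriv a (christoffel G a i j) y
    - ∑ a, partialDeriv i (christoffel G a a j) y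
    + ∑ a, ∑ b, christoffel G a a b y * christoffel G b i j y
    - ∑ a, ∑ b, christoffel G a i b y * christoffel G b a j y

/-- The scalar curvature `g^{ij} R_ij`. -/
def scalarCurvature {n : ℕ} (G : Coord n → Matrix (Fin n) (Fin n) ℝ) (y : Coord n) : ℝ :=
  ∑ i, ∑ j, (G y)⁻¹ i j * ricci G i j y

/-- The Hessian `∂_i ∂_j u - Γ^k_ij ∂_k u`. -/
def hessian {n : ℕ} (G : Coord n → Matrix (Fin n) (Fin n) ℝ) (u : Coord n → ℝ) (i j : Fin n)
    (y : Coord n) : ℝ :=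
  partialDeriv i (partialDeriv j u) y - ∑ k, christoffel G k i j y * partialDeriv k u y

/-- The Laplace-Beltrami operator, the trace `g^{ij} (Hess u)_ij` of the Hessian. -/
def laplacian {n : ℕ} (G : Coord n → Matrix (Fin n) (Fin n) ℝ) (u : Coord n → ℝ)
    (y : Coord n) : ℝ :=
  ∑ i, ∑ j, (G y)⁻¹ i j * hessian G u i j y

/-- The squared norm `|A|² = g^{ik} g^{jl} A_ij A_kl` of a covariant 2-tensor, for the metric with
component matrix `B` at the point in question. -/
def tensorNormSq {n : ℕ} (B A : Matrix (Fin n) (Fin n) ℝ) : ℝ :=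
  ∑ i, ∑ j, ∑ k, ∑ l, B⁻¹ i k * B⁻¹ j l * A i j * A k l

/-- The Bakry-Émery Ricci tensor `Ric + Hess f`. -/
def bakryEmeryRicci {n : ℕ} (G : Coord n → Matrix (Fin n) (Fin n) ℝ) (f : Coord n → ℝ)
    (i j : Fin n) (y : Coord n) : ℝ :=
  ricci G i j y + hessian G f i j y

/-! ### Objects on the manifold -/

/-- The smooth charts of `M`, i.e. the members of its maximal smooth atlas. An equation between
tensors on `M` is stated as the equality of their components in every smooth chart. -/
abbrev smoothCharts (n : ℕ) (M : Type*) [TopologicalSpace M] [ChartedSpace (Coord n) M] :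
    Set (OpenPartialHomeomorph M (Coord n)) :=
  IsManifold.maximalAtlas (𝓡 n) ∞ M

/-- Smooth Riemannian metrics on `M`. -/
abbrev Metric (n : ℕ) (M : Type*) [TopologicalSpace M] [ChartedSpace (Coord n) M]
    [IsManifold (𝓡 n) ∞ M] : Type _ :=
  Bundle.ContMDiffRiemannianMetric (𝓡 n) ∞ (Coord n) (fun x : M => TangentSpace (𝓡 n) x)

/-- The coordinate vector field `∂_i` of the chart `e`, at the point with coordinates `y`. -/
def coordVector {n : ℕ} {M : Type*} [TopologicalSpace M] [ChartedSpace (Coord n) M]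
    (e : OpenPartialHomeomorph M (Coord n)) (y : Coord n) (i : Fin n) :
    TangentSpace (𝓡 n) (e.symm y) :=
  mfderiv (𝓡 n) (𝓡 n) e.symm y (EuclideanSpace.single i (1 : ℝ) : Coord n)

/-- The components `g_ij = g(∂_i, ∂_j)` of the metric `g` in the chart `e`. -/
def metricMatrix {n : ℕ} {M : Type*} [TopologicalSpace M] [ChartedSpace (Coord n) M]
    [IsManifold (𝓡 n) ∞ M] (g : Metric n M) (e : OpenPartialHomeomorph M (Coord n))
    (y : Coord n) : Matrix (Fin n) (Fin n) ℝ :=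
  Matrix.of fun i j => g.inner (e.symm y) (coordVector e y i) (coordVector e y j)

/-- `u` is smooth on `M × [0, T)`. -/
def SmoothUpTo (n : ℕ) {M : Type*} [TopologicalSpace M] [ChartedSpace (Coord n) M]
    (T : ℝ) (u : ℝ → M → ℝ) : Prop :=
  ContMDiffOn (𝓘(ℝ, ℝ).prod (𝓡 n)) 𝓘(ℝ, ℝ) ∞ (fun q : ℝ × M => u q.1 q.2) (Ico 0 T ×ˢ univ)

/-- `(M, g(t), p(t))`, `t ∈ [0, T)`, is a smooth conformal Ricci flow of metrics of constant scalar
curvature `-m(m+1)` on a manifold of dimension `m + 1`: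
`∂_t g = -2 (Ric + (m + p) g)` and `(-Δ + (m+1)) p = (1/m) |Ric + m g|²`. -/
structure IsConformalRicciFlow (m : ℕ) {M : Type*} [TopologicalSpace M]
    [ChartedSpace (Coord (m + 1)) M] [IsManifold (𝓡 (m + 1)) ∞ M]
    (T : ℝ) (g : ℝ → Metric (m + 1) M) (p : ℝ → M → ℝ) : Prop where
  smooth_metric : ∀ e ∈ smoothCharts (m + 1) M, ∀ i j,
    ContDiffOn ℝ ∞ (fun q : ℝ × Coord (m + 1) => metricMatrix (g q.1) e q.2 i j)
      (Ico 0 T ×ˢ e.target)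
  smooth_pressure : SmoothUpTo (m + 1) T p
  scalar_curvature : ∀ t ∈ Ico 0 T, ∀ e ∈ smoothCharts (m + 1) M, ∀ y ∈ e.target,
    scalarCurvature (metricMatrix (g t) e) y = -((m : ℝ) * (m + 1))
  evolution : ∀ t ∈ Ico 0 T, ∀ e ∈ smoothCharts (m + 1) M, ∀ y ∈ e.target, ∀ i j,
    HasDerivWithinAt (fun s => metricMatrix (g s) e y i j)
      (-2 * (ricci (metricMatrix (g t) e) i j y
        + ((m : ℝ) + p t (e.symm y)) * metricMatrix (g t) e y i j)) (Ico 0 T) t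
  pressure : ∀ t ∈ Ico 0 T, ∀ e ∈ smoothCharts (m + 1) M, ∀ y ∈ e.target,
    -laplacian (metricMatrix (g t) e) (p t ∘ e.symm) y + ((m : ℝ) + 1) * p t (e.symm y)
      = 1 / (m : ℝ) * tensorNormSq (metricMatrix (g t) e y)
          (Matrix.of fun i j => ricci (metricMatrix (g t) e) i j y
            + (m : ℝ) * metricMatrix (g t) e y i j)

/-- `p̄(t) = max_{x ∈ M} p(x, t)`. -/
def maxPressure {M : Type*} (p : ℝ → M → ℝ) (t : ℝ) : ℝ := ⨆ x, p t x

/-- The weight `H = (4π(T - t))^{-(m+1)/2} e^{-f}`. -/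
def weight (m : ℕ) {M : Type*} (T : ℝ) (f : ℝ → M → ℝ) (t : ℝ) (x : M) : ℝ :=
  (4 * Real.pi * (T - t)) ^ (-(((m : ℝ) + 1) / 2)) * Real.exp (-f t x)

/-- `f` is smooth on `M × [0, T)` and the weight `H` that it defines solves the conjugate heat
equation `∂_t H = -Δ H + (m+1) p H` along the flow. -/
structure IsConjugateHeatPotential (m : ℕ) {M : Type*} [TopologicalSpace M]
    [ChartedSpace (Coord (m + 1)) M] [IsManifold (𝓡 (m + 1)) ∞ M]
    (T : ℝ) (g : ℝ → Metric (m + 1) M) (p f : ℝ → M → ℝ) : Prop where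
  smooth : SmoothUpTo (m + 1) T f
  conjugate_heat : ∀ t ∈ Ico 0 T, ∀ e ∈ smoothCharts (m + 1) M, ∀ y ∈ e.target,
    HasDerivWithinAt (fun s => weight m T f s (e.symm y))
      (-laplacian (metricMatrix (g t) e) (weight m T f t ∘ e.symm) y
        + ((m : ℝ) + 1) * p t (e.symm y) * weight m T f t (e.symm y)) (Ico 0 T) t

/-- `Ric_f ≤ (k/(2h) + R/(m+1)) g` as quadratic forms, at all times in `[0, T)`. -/
def BakryEmeryBound (m : ℕ) {M : Type*} [TopologicalSpace M]
    [ChartedSpace (Coord (m + 1)) M] [IsManifold (𝓡 (m + 1)) ∞ M]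
    (T : ℝ) (g : ℝ → Metric (m + 1) M) (f : ℝ → M → ℝ) (h k : ℝ → ℝ) : Prop :=
  ∀ t ∈ Ico 0 T, ∀ e ∈ smoothCharts (m + 1) M, ∀ y ∈ e.target, ∀ ξ : Fin (m + 1) → ℝ,
    ∑ i, ∑ j, bakryEmeryRicci (metricMatrix (g t) e) (f t ∘ e.symm) i j y * ξ i * ξ j
      ≤ (k t / (2 * h t) + scalarCurvature (metricMatrix (g t) e) y / ((m : ℝ) + 1))
        * ∑ i, ∑ j, metricMatrix (g t) e y i j * ξ i * ξ j

/-- `v` is a classical solution on `M × [0, T)` of `∂_t v - Δ_{g(t)} v = p̄(t) v`: it is `C²` in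
space, its space derivatives of order at most two are continuous in time and space, and the
equation holds (so that `∂_t v` is continuous too). Every smooth solution is one. Joint smoothness
is not required, because `p̄` need not be differentiable. -/
structure IsHeatSolution (m : ℕ) {M : Type*} [TopologicalSpace M]
    [ChartedSpace (Coord (m + 1)) M] [IsManifold (𝓡 (m + 1)) ∞ M]
    (T : ℝ) (g : ℝ → Metric (m + 1) M) (p v : ℝ → M → ℝ) : Prop where
  contMDiff : ∀ t ∈ Ico 0 T, ContMDiff (𝓡 (m + 1)) 𝓘(ℝ, ℝ) 2 (v t)
  continuousOn : ContinuousOn (fun q : ℝ × M => v q.1 q.2) (Ico 0 T ×ˢ univ)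
  continuousOn_deriv : ∀ e ∈ smoothCharts (m + 1) M, ∀ i,
    ContinuousOn (fun q : ℝ × Coord (m + 1) => partialDeriv i (v q.1 ∘ e.symm) q.2)
      (Ico 0 T ×ˢ e.target)
  continuousOn_deriv_deriv : ∀ e ∈ smoothCharts (m + 1) M, ∀ i j,
    ContinuousOn (fun q : ℝ × Coord (m + 1) =>
      partialDeriv i (partialDeriv j (v q.1 ∘ e.symm)) q.2) (Ico 0 T ×ˢ e.target)
  heat : ∀ t ∈ Ico 0 T, ∀ e ∈ smoothCharts (m + 1) M, ∀ y ∈ e.target,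
    HasDerivWithinAt (fun s => v s (e.symm y))
      (laplacian (metricMatrix (g t) e) (v t ∘ e.symm) y
        + maxPressure p t * v t (e.symm y)) (Ico 0 T) t

end ConformalRicci

end

namespace ConformalRicci

open MeasureTheory Filter Topology

/-! The proof is the frequency (logarithmic convexity) method for parabolic equations. Along the
flow the metric is jointly smooth and positive definite, and `maxPressure p` is bounded on compact
time intervals. In every chart `v` therefore solves `∂_t V = L V + c V`, where `L = A^{ab} ∂_a ∂_b +
q^a ∂_a` is elliptic and `c` is bounded (`isLocalSolution_of_isHeatSolution`).

Finitely many charts with bump functions `ψ_i` replace the Riemannian volume: integrals are taken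
against `ψ_i dy` and summed. Write `z = L v`, `I = ∫ v²`, `P = ∫ v z`, `Q = ∫ z²`, and let `D` be
the Dirichlet energy `∫ A(∂v, ∂v)`. Since `L` is not symmetric for this measure, integration by
parts leaves a first order term `B(u) = Σ_i ∫ u γ^b ∂_b v` (`defectForm`), so that `D = -P - B(v)`,
`I' = 2P + 2cI`, `D' = R - 2Q - 2B(z) + 2cD`, where `R` comes from `∂_t A` and `R ≤ C D`. In `D' I -
D I'` the terms with `c` cancel, and with `α = P/I` there remains `R I - 2 I ∫ (z - αv)² - 2 I B(z -
αv)`. The estimate `2|B(u)| ≤ 2 ∫ u² + C D` (`exists_defectForm_le`) absorbs the last term, so `N =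
D/I` satisfies `N' ≤ C N`. Hence `N` stays bounded wherever `I > 0`, `I' ≥ -C(N + 1) I`, and `I`
cannot reach zero in finite time (`eq_zero_of_frequency_bound`).

Two points need care. First, `γ` contains derivatives of `ψ_i`, which are not dominated by `ψ_i`.
Where `ψ_i` degenerates, some other `ψ_j` equals one, and comparing charts on overlaps bounds
unweighted integrals by weighted ones (`exists_sum_setIntegral_le`). Second, `v` is only `C²` in
space and differentiable in time, so `∂_t ∂_a v` need not exist. The energy is differentiated by
integrating by parts in its difference `D(s) - D(t)` before passing to the limit
(`hasDerivAt_energy`). -/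

/-! ### The frequency argument for functions of time. -/

/-- A nonnegative function whose logarithmic derivative is controlled from below by a frequency
`D / I` of at most exponential growth vanishes identically if it vanishes at the final time. -/
theorem eq_zero_of_frequency_bound {I D I' D' : ℝ → ℝ} {a b C : ℝ} (hC : 0 ≤ C)
    (hI : ∀ t ∈ Icc a b, HasDerivAt I (I' t) t) (hD : ∀ t ∈ Icc a b, HasDerivAt D (D' t) t)
    (hI0 : ∀ t ∈ Icc a b, 0 ≤ I t) (hD0 : ∀ t ∈ Icc a b, 0 ≤ D t)
    (hI' : ∀ t ∈ Icc a b, -C * (D t + I t) ≤ I' t)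
    (hN : ∀ t ∈ Icc a b, 0 < I t → D' t * I t - D t * I' t ≤ C * D t * I t)
    (hb : I b = 0) : ∀ t ∈ Icc a b, I t = 0 := by
  intro t₀ ht₀
  by_contra hne
  have hpos : 0 < I t₀ := lt_of_le_of_ne (hI0 t₀ ht₀) (Ne.symm hne)
  have hsub : Icc t₀ b ⊆ Icc a b := Icc_subset_Icc_left ht₀.1
  have hcont : ContinuousOn I (Icc t₀ b) := fun t ht =>
    (hI t (hsub ht)).continuousAt.continuousWithinAt
  -- The infimum `t₁` of `S` is the first zero of `I` after `t₀`; the frequency `D / I` makes sense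
  -- on `[t₀, t₁)`.
  set S : Set ℝ := Icc t₀ b ∩ I ⁻¹' {0} with hS
  have hSc : IsCompact S :=
    isCompact_Icc.of_isClosed_subset
      (hcont.preimage_isClosed_of_isClosed isClosed_Icc isClosed_singleton) inter_subset_left
  have hSn : S.Nonempty := ⟨b, ⟨ht₀.2, le_rfl⟩, hb⟩
  set t₁ := sInf S with ht₁
  have h1 : t₁ ∈ S := hSc.sInf_mem hSn
  have hlt : t₀ < t₁ := by
    refine lt_of_le_of_ne h1.1.1 fun h => hne ?_
    rw [h]; exact h1.2
  have hsub1 : Icc t₀ t₁ ⊆ Icc a b := (Icc_subset_Icc_right h1.1.2).trans hsub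
  have hIpos : ∀ t ∈ Ico t₀ t₁, 0 < I t := by
    intro t ht
    refine lt_of_le_of_ne (hI0 t (hsub1 ⟨ht.1, ht.2.le⟩)) fun h => ?_
    have : t ∈ S := ⟨⟨ht.1, ht.2.le.trans h1.1.2⟩, h.symm⟩
    exact absurd (csInf_le hSc.bddBelow this) (not_le.mpr ht.2)
  have hNd : ∀ t ∈ Ico t₀ t₁, HasDerivAt (fun t => D t / I t * Real.exp (-C * t))
      ((D' t * I t - D t * I' t) / I t ^ 2 * Real.exp (-C * t)
        + D t / I t * (Real.exp (-C * t) * (-C))) t := by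
    intro t ht
    have hm := hsub1 ⟨ht.1, ht.2.le⟩
    have he : HasDerivAt (fun t => Real.exp (-C * t)) (Real.exp (-C * t) * (-C)) t := by
      simpa using ((hasDerivAt_id t).const_mul (-C)).exp
    exact ((hD t hm).div (hI t hm) (hIpos t ht).ne').mul he
  -- The quotient rule and `hN` give `N' ≤ C N` for `N = D / I`, so `N e^{-Ct}` does not increase.
  have hanti : AntitoneOn (fun t => D t / I t * Real.exp (-C * t)) (Ico t₀ t₁) := by
    refine antitoneOn_of_deriv_nonpos (convex_Ico _ _)
      (fun t ht => (hNd t ht).continuousAt.continuousWithinAt)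
      (fun t ht => (hNd t (interior_subset ht)).differentiableAt.differentiableWithinAt) ?_
    intro t ht
    have ht' := interior_subset ht
    rw [(hNd t ht').deriv]
    have hp := hIpos t ht'
    have := hN t (hsub1 ⟨ht'.1, ht'.2.le⟩) hp
    have h2 : (D' t * I t - D t * I' t) / I t ^ 2 ≤ C * (D t / I t) := by
      rw [div_le_iff₀ (by positivity)]
      calc _ ≤ C * D t * I t := this
        _ = _ := by field_simp
    have he := Real.exp_pos (-C * t)
    nlinarith
  set N₁ := D t₀ / I t₀ * Real.exp (C * (b - t₀)) with hN₁
  have hN0 : 0 ≤ D t₀ / I t₀ := div_nonneg (hD0 _ ht₀) hpos.le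
  have hDI : ∀ t ∈ Ico t₀ t₁, D t ≤ N₁ * I t := by
    intro t ht
    have h3 := hanti ⟨le_rfl, hlt⟩ ht ht.1
    simp only at h3
    rw [← div_le_iff₀ (hIpos t ht)]
    have h4 : D t / I t = D t / I t * Real.exp (-C * t) * Real.exp (C * t) := by
      rw [mul_assoc, ← Real.exp_add]; simp
    rw [h4]
    calc _ ≤ D t₀ / I t₀ * Real.exp (-C * t₀) * Real.exp (C * t) := by gcongr
      _ = D t₀ / I t₀ * Real.exp (C * (t - t₀)) := by
        rw [mul_assoc, ← Real.exp_add]; ring_nf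
      _ ≤ N₁ := by
        have : t ≤ b := ht.2.le.trans h1.1.2
        rw [hN₁]; gcongr
  -- With `D ≤ N₁ I`, the lower bound on `I'` becomes `I' ≥ -L I`. Then `I e^{Lt}` does not decrease
  -- up to and including `t₁`, which contradicts `I t₁ = 0 < I t₀`.
  set L := C * (N₁ + 1) with hL
  have hd : ∀ t ∈ Icc t₀ t₁, HasDerivAt (fun t => I t * Real.exp (L * t))
      (I' t * Real.exp (L * t) + I t * (Real.exp (L * t) * L)) t := by
    intro t ht
    have he : HasDerivAt (fun t => Real.exp (L * t)) (Real.exp (L * t) * L) t := by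
      simpa using ((hasDerivAt_id t).const_mul L).exp
    exact (hI t (hsub1 ht)).mul he
  have hmono : MonotoneOn (fun t => I t * Real.exp (L * t)) (Icc t₀ t₁) := by
    refine monotoneOn_of_deriv_nonneg (convex_Icc _ _)
      (fun t ht => (hd t ht).continuousAt.continuousWithinAt)
      (fun t ht => (hd t (interior_subset ht)).differentiableAt.differentiableWithinAt) ?_
    intro t ht
    rw [(hd t (interior_subset ht)).deriv]
    rw [interior_Icc] at ht
    have h5 := hDI t ⟨ht.1.le, ht.2⟩
    have h6 := hI' t (hsub1 ⟨ht.1.le, ht.2.le⟩)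
    have he := Real.exp_pos (L * t)
    have h7 : 0 ≤ I' t + I t * L := by
      have := mul_le_mul_of_nonneg_left h5 hC
      rw [hL]; linarith
    have := mul_nonneg h7 he.le
    linarith
  have h8 := hmono ⟨le_rfl, hlt.le⟩ ⟨hlt.le, le_rfl⟩ hlt.le
  have h9 : I t₁ = 0 := h1.2
  simp only [h9, zero_mul] at h8
  exact absurd h8 (not_le.mpr (mul_pos hpos (Real.exp_pos _)))

/-! ### Differentiation under the integral sign. -/

/-- Differentiation at the base time `t` of the integral of `(Q s - Q t) r s`, where `r` is merely
continuous. -/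
theorem hasDerivAt_setIntegral_sub_mul {E : Type*} [TopologicalSpace E] [T2Space E]
    [MeasurableSpace E] [BorelSpace E] {μ : Measure E} [IsFiniteMeasureOnCompacts μ]
    {K : Set E} (hK : IsCompact K) {Q Q' r : ℝ → E → ℝ} {t ε : ℝ} (hε : 0 < ε)
    (hQc : ContinuousOn (fun z : ℝ × E => Q z.1 z.2) (Icc (t - ε) (t + ε) ×ˢ K))
    (hQ : ∀ s ∈ Icc (t - ε) (t + ε), ∀ y ∈ K, HasDerivAt (fun s => Q s y) (Q' s y) s)
    {C : ℝ} (hQ' : ∀ s ∈ Icc (t - ε) (t + ε), ∀ y ∈ K, |Q' s y| ≤ C)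
    (hr : ContinuousOn (fun z : ℝ × E => r z.1 z.2) (Icc (t - ε) (t + ε) ×ˢ K)) :
    HasDerivAt (fun s => ∫ y in K, (Q s y - Q t y) * r s y ∂μ)
      (∫ y in K, Q' t y * r t y ∂μ) t := by
  have hJ : Icc (t - ε) (t + ε) ∈ 𝓝 t := Icc_mem_nhds (by linarith) (by linarith)
  have htJ : t ∈ Icc (t - ε) (t + ε) := mem_of_mem_nhds hJ
  have slice : ∀ {F : ℝ → E → ℝ},
      ContinuousOn (fun z : ℝ × E => F z.1 z.2) (Icc (t - ε) (t + ε) ×ˢ K) →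
      ∀ s ∈ Icc (t - ε) (t + ε), ContinuousOn (F s) K := fun hF s hs =>
    hF.comp (f := fun y => (s, y)) (by fun_prop) fun y hy => ⟨hs, hy⟩
  obtain ⟨R, hR⟩ := (isCompact_Icc.prod hK).exists_bound_of_continuousOn hr
  rw [hasDerivAt_iff_tendsto_slope]
  have hEq : slope (fun s => ∫ y in K, (Q s y - Q t y) * r s y ∂μ) t
      = fun s => ∫ y in K, (s - t)⁻¹ * ((Q s y - Q t y) * r s y) ∂μ := by
    ext s
    simp [slope_def_field, integral_const_mul, div_eq_inv_mul]
  rw [hEq]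
  -- The mean value inequality bounds the difference quotients of `Q` by `C`, and `R` bounds `r` on
  -- the compact product, so the constant `C * R` dominates.
  refine tendsto_integral_filter_of_dominated_convergence (fun _ => C * R) ?_ ?_ ?_ ?_
  · filter_upwards [mem_nhdsWithin_of_mem_nhds hJ] with s hs
    refine ContinuousOn.aestronglyMeasurable ?_ hK.measurableSet
    exact continuousOn_const.mul (((slice hQc s hs).sub (slice hQc t htJ)).mul (slice hr s hs))
  · filter_upwards [mem_nhdsWithin_of_mem_nhds hJ, self_mem_nhdsWithin] with s hs hst
    refine (ae_restrict_iff' hK.measurableSet).mpr (Eventually.of_forall fun y hy => ?_)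
    have h1 : ‖Q s y - Q t y‖ ≤ C * ‖s - t‖ :=
      (convex_Icc (t - ε) (t + ε)).norm_image_sub_le_of_norm_hasDerivWithin_le
        (fun x hx => (hQ x hx y hy).hasDerivWithinAt) (fun x hx => hQ' x hx y hy) htJ hs
    have h2 : ‖r s y‖ ≤ R := hR (s, y) ⟨hs, hy⟩
    have h3 : 0 < ‖s - t‖ := norm_pos_iff.mpr (sub_ne_zero.mpr hst)
    have hC : 0 ≤ C := (abs_nonneg _).trans (hQ' t htJ y hy)
    rw [norm_mul, norm_mul, norm_inv]
    calc _ ≤ ‖s - t‖⁻¹ * (C * ‖s - t‖ * R) := by gcongr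
      _ = C * R := by field_simp
  · have : Fact (μ K < ⊤) := ⟨hK.measure_lt_top⟩
    exact integrable_const _
  · refine (ae_restrict_iff' hK.measurableSet).mpr (Eventually.of_forall fun y hy => ?_)
    have h1 := (hasDerivAt_iff_tendsto_slope.mp (hQ t htJ y hy))
    have h2 : ContinuousAt (fun s => r s y) t := by
      have : ContinuousOn (fun s => r s y) (Icc (t - ε) (t + ε)) :=
        hr.comp (f := fun s => (s, y)) (by fun_prop) fun s hs => ⟨hs, hy⟩
      exact this.continuousAt hJ
    refine (h1.mul (h2.tendsto.mono_left nhdsWithin_le_nhds)).congr fun s => ?_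
    simp [slope_def_field, div_eq_inv_mul, mul_assoc]

/-! ### Integration by parts in coordinates. -/

/-- The divergence theorem for `ψ Φ`, with `ψ` compactly supported in the open set where `Φ` is
defined. -/
theorem setIntegral_partialDeriv_mul_add {n : ℕ} {U : Set (Coord n)} (hU : IsOpen U)
    {ψ Φ : Coord n → ℝ} (hψ : ContDiff ℝ 1 ψ) (hc : HasCompactSupport ψ) (hsupp : tsupport ψ ⊆ U)
    (hΦ : ContDiffOn ℝ 1 Φ U) (b : Fin n) :
    ∫ y in tsupport ψ, (partialDeriv b ψ y * Φ y + ψ y * partialDeriv b Φ y) = 0 := by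
  have hF : ContDiff ℝ 1 (fun y => ψ y * Φ y) := by
    rw [contDiff_iff_contDiffAt]
    intro y
    by_cases hy : y ∈ tsupport ψ
    · exact hψ.contDiffAt.mul (hΦ.contDiffAt (hU.mem_nhds (hsupp hy)))
    · have : (fun y => ψ y * Φ y) =ᶠ[𝓝 y] fun _ => 0 := by
        filter_upwards [(isClosed_tsupport ψ).isOpen_compl.mem_nhds hy] with z hz
        simp [image_eq_zero_of_notMem_tsupport hz]
      exact contDiffAt_const.congr_of_eventuallyEq this
  have hFc : HasCompactSupport (fun y => ψ y * Φ y) := hc.mul_right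
  have hd : Continuous fun y => fderiv ℝ (fun y => ψ y * Φ y) y (EuclideanSpace.single b 1) :=
    (hF.continuous_fderiv one_ne_zero).clm_apply continuous_const
  have hdc : HasCompactSupport
      fun y => fderiv ℝ (fun y => ψ y * Φ y) y (EuclideanSpace.single b 1) :=
    hFc.fderiv_apply ℝ _
  -- Integrating by parts against the constant function `1` shows that the derivative of `ψ Φ` has
  -- integral zero.
  have key := integral_mul_fderiv_eq_neg_fderiv_mul_of_integrable (𝕜 := ℝ) (μ := volume)
    (f := fun _ : Coord n => (1 : ℝ)) (g := fun y => ψ y * Φ y)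
    (v := EuclideanSpace.single b (1 : ℝ)) (by simp)
    (by simpa using hd.integrable_of_hasCompactSupport hdc)
    (by simpa using hF.continuous.integrable_of_hasCompactSupport hFc)
    (fun y _ => differentiableAt_const _)
    (fun y _ => hF.contDiffAt.differentiableAt one_ne_zero)
  have hcompl : ∫ y in tsupport ψ,
      fderiv ℝ (fun y => ψ y * Φ y) y (EuclideanSpace.single b 1) = 0 := by
    rw [setIntegral_eq_integral_of_forall_compl_eq_zero]
    · simpa using key
    · intro y hy
      have h0 : y ∉ tsupport (fun y => ψ y * Φ y) := fun h => hy (tsupport_mul_subset_left h)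
      have : fderiv ℝ (fun y => ψ y * Φ y) y = 0 := by
        by_contra hne
        exact h0 (support_fderiv_subset ℝ hne)
      rw [this]; simp
  rw [← hcompl]
  refine setIntegral_congr_fun (isClosed_tsupport ψ).measurableSet fun y hy => ?_
  have h1 : DifferentiableAt ℝ ψ y := hψ.contDiffAt.differentiableAt one_ne_zero
  have h2 : DifferentiableAt ℝ Φ y :=
    (hΦ.contDiffAt (hU.mem_nhds (hsupp hy))).differentiableAt one_ne_zero
  simp only [partialDeriv, fderiv_fun_mul h1 h2, add_apply, smul_apply, smul_eq_mul]
  ring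

theorem contDiffOn_partialDeriv {n : ℕ} {U : Set (Coord n)} (hU : IsOpen U) {u : Coord n → ℝ}
    {k l : ℕ∞ω} (hu : ContDiffOn ℝ l u U) (hkl : k + 1 ≤ l) (a : Fin n) :
    ContDiffOn ℝ k (partialDeriv a u) U :=
  (hu.fderiv_of_isOpen hU hkl).clm_apply contDiffOn_const

theorem partialDeriv_mul {n : ℕ} {u w : Coord n → ℝ} {y : Coord n} (hu : DifferentiableAt ℝ u y)
    (hw : DifferentiableAt ℝ w y) (a : Fin n) :
    partialDeriv a (fun z => u z * w z) y
      = u y * partialDeriv a w y + w y * partialDeriv a u y := by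
  simp [partialDeriv, fderiv_fun_mul hu hw]

/-- The operator `A^{ab} ∂_a ∂_b w + q^a ∂_a w`. -/
noncomputable def ellipticOp {n : ℕ} (A : Fin n → Fin n → Coord n → ℝ) (q : Fin n → Coord n → ℝ)
    (w : Coord n → ℝ) (y : Coord n) : ℝ :=
  ∑ a, ∑ b, A a b y * partialDeriv a (partialDeriv b w) y + ∑ a, q a y * partialDeriv a w y

/-- The bilinear form `A^{ab} ∂_a u ∂_b w`. -/
noncomputable def gradForm {n : ℕ} (A : Fin n → Fin n → Coord n → ℝ) (u w : Coord n → ℝ) (y : Coord n) : ℝ :=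
  ∑ a, ∑ b, A a b y * partialDeriv a u y * partialDeriv b w y

/-- The first order coefficients by which `-ψ (A^{ab} ∂_a ∂_b + q^a ∂_a)` differs from the
operator of the form `ψ A^{ab} ∂_a u ∂_b w`. -/
noncomputable def defect {n : ℕ} (ψ : Coord n → ℝ) (A : Fin n → Fin n → Coord n → ℝ) (q : Fin n → Coord n → ℝ)
    (b : Fin n) (y : Coord n) : ℝ :=
  ∑ a, (partialDeriv a ψ y * A a b y + ψ y * partialDeriv a (A a b) y) - ψ y * q b y

/-- The field `ψ A^{ab} u ∂_b w` has compact support in `U`, so its divergence integrates to zero.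
The derivative falling on `u` gives the form, the one on `∂_b w` the second order part of the
operator, and those on `ψ` and `A` the defect. The drift `q` enters the operator and the defect with
opposite effect and is therefore arbitrary. -/
theorem setIntegral_gradForm {n : ℕ} {U : Set (Coord n)} (hU : IsOpen U)
    {ψ : Coord n → ℝ} (hψ : ContDiff ℝ 1 ψ) (hc : HasCompactSupport ψ) (hsupp : tsupport ψ ⊆ U)
    {A : Fin n → Fin n → Coord n → ℝ} (hA : ∀ a b, ContDiffOn ℝ 1 (A a b) U)
    {q : Fin n → Coord n → ℝ} (hq : ∀ a, ContinuousOn (q a) U)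
    {u w : Coord n → ℝ} (hu : ContDiffOn ℝ 1 u U) (hw : ContDiffOn ℝ 2 w U) :
    ∫ y in tsupport ψ, ψ y * gradForm A u w y
      = -(∫ y in tsupport ψ, ψ y * (u y * ellipticOp A q w y))
        - ∫ y in tsupport ψ, u y * ∑ b, defect ψ A q b y * partialDeriv b w y := by
  have hw1 : ∀ b, ContDiffOn ℝ 1 (partialDeriv b w) U := fun b =>
    contDiffOn_partialDeriv hU hw (by norm_num) b
  have cA := fun a b => (hA a b).continuousOn.mono hsupp
  have cA' := fun a b c => (contDiffOn_partialDeriv (k := 0) hU (hA a b) (by norm_num)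
    c).continuousOn.mono hsupp
  have cq := fun a => (hq a).mono hsupp
  have cu := hu.continuousOn.mono hsupp
  have cu' := fun a => (contDiffOn_partialDeriv (k := 0) hU hu (by norm_num)
    a).continuousOn.mono hsupp
  have cw' := fun a => (hw1 a).continuousOn.mono hsupp
  have cw'' := fun a b => (contDiffOn_partialDeriv (k := 0) hU (hw1 a) (by norm_num)
    b).continuousOn.mono hsupp
  have cψ := hψ.continuous.continuousOn (s := tsupport ψ)
  have cψ' := fun a => (contDiffOn_partialDeriv (k := 0) isOpen_univ (contDiffOn_univ.mpr hψ)
    (by norm_num) a).continuousOn.mono (subset_univ (tsupport ψ))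
  have hI1 : IntegrableOn (fun y => ψ y * gradForm A u w y) (tsupport ψ) :=
    ContinuousOn.integrableOn_compact hc (by unfold gradForm; fun_prop)
  have hI2 : IntegrableOn (fun y => ψ y * (u y * ellipticOp A q w y)) (tsupport ψ) :=
    ContinuousOn.integrableOn_compact hc (by unfold ellipticOp; fun_prop)
  have hI3 : IntegrableOn (fun y => u y * ∑ b, defect ψ A q b y * partialDeriv b w y)
      (tsupport ψ) :=
    ContinuousOn.integrableOn_compact hc (by unfold defect; fun_prop)
  have hΦ : ∀ a b, ContDiffOn ℝ 1 (fun y => A a b y * (partialDeriv b w y * u y)) U :=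
    fun a b => (hA a b).mul ((hw1 b).mul hu)
  have key : ∫ y in tsupport ψ, ∑ a, ∑ b,
      (partialDeriv a ψ y * (A a b y * (partialDeriv b w y * u y))
        + ψ y * partialDeriv a (fun y => A a b y * (partialDeriv b w y * u y)) y) = 0 := by
    have hi : ∀ a b, IntegrableOn (fun y =>
        (partialDeriv a ψ y * (A a b y * (partialDeriv b w y * u y))
        + ψ y * partialDeriv a (fun y => A a b y * (partialDeriv b w y * u y)) y))
        (tsupport ψ) := by
      intro a b
      have := (contDiffOn_partialDeriv (k := 0) hU (hΦ a b) (by norm_num)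
        a).continuousOn.mono hsupp
      exact ContinuousOn.integrableOn_compact hc (by fun_prop)
    rw [integral_finsetSum _ fun a _ => integrable_finsetSum _ fun b _ => hi a b]
    refine Finset.sum_eq_zero fun a _ => ?_
    rw [integral_finsetSum _ fun b _ => hi a b]
    exact Finset.sum_eq_zero fun b _ =>
      setIntegral_partialDeriv_mul_add hU hψ hc hsupp (hΦ a b) a
  -- With everything moved to one side, the integrand agrees on the support of `ψ` with the
  -- divergence in `key`.
  rw [← sub_eq_zero, ← key, sub_sub_eq_add_sub, sub_neg_eq_add]
  rw [← integral_add hI1 hI3,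
    ← integral_add (f := fun y => ψ y * gradForm A u w y
      + u y * ∑ b, defect ψ A q b y * partialDeriv b w y) (hI1.add hI3) hI2]
  refine setIntegral_congr_fun (isClosed_tsupport ψ).measurableSet fun y hy => ?_
  have hy' := hU.mem_nhds (hsupp hy)
  have dA := fun a b => ((hA a b).contDiffAt hy').differentiableAt one_ne_zero
  have dw := fun b => ((hw1 b).contDiffAt hy').differentiableAt one_ne_zero
  have du := (hu.contDiffAt hy').differentiableAt one_ne_zero
  have hexp : ∀ a b, partialDeriv a (fun y => A a b y * (partialDeriv b w y * u y)) y
      = A a b y * (partialDeriv b w y * partialDeriv a u y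
          + u y * partialDeriv a (partialDeriv b w) y)
        + partialDeriv b w y * u y * partialDeriv a (A a b) y := by
    intro a b
    rw [partialDeriv_mul (w := fun z => partialDeriv b w z * u z) (dA a b) ((dw b).mul du),
      partialDeriv_mul (dw b) du]
  have h1 : ∑ b, defect ψ A q b y * partialDeriv b w y
      = ∑ a, ∑ b, (partialDeriv a ψ y * A a b y + ψ y * partialDeriv a (A a b) y)
          * partialDeriv b w y - ψ y * ∑ b, q b y * partialDeriv b w y := by
    rw [Finset.sum_comm, Finset.mul_sum, ← Finset.sum_sub_distrib]
    refine Finset.sum_congr rfl fun b _ => ?_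
    rw [defect, sub_mul, Finset.sum_mul]
    ring
  simp only [h1, gradForm, ellipticOp, hexp]
  rw [mul_sub, mul_add, mul_add]
  have h2 : ∀ s₁ s₂ s₃ s₄ : ℝ, s₁ + (s₂ - u y * (ψ y * s₄)) + (s₃ + ψ y * (u y * s₄))
      = s₁ + s₂ + s₃ := fun _ _ _ _ => by ring
  rw [h2]
  simp only [Finset.mul_sum, ← Finset.sum_add_distrib]
  refine Finset.sum_congr rfl fun a _ => Finset.sum_congr rfl fun b _ => ?_
  ring

/-! ### Smooth charts, bump functions and comparison of integrals on overlaps. -/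

section Charts

variable {n : ℕ} {M : Type*} [TopologicalSpace M] [ChartedSpace (Coord n) M]

/-- The inequality `2 ≤ ∞` of smoothness exponents. -/
theorem two_le_infty : (2 : ℕ∞ω) ≤ ∞ := by
  exact WithTop.coe_le_coe.mpr (le_top : (2 : ℕ∞) ≤ ⊤)

theorem contDiffOn_transition {e e' : OpenPartialHomeomorph M (Coord n)}
    (he : e ∈ smoothCharts n M) (he' : e' ∈ smoothCharts n M) :
    ContDiffOn ℝ ∞ (fun y => e' (e.symm y)) (e.symm ≫ₕ e').source := by
  rw [← contMDiffOn_iff_contDiffOn]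
  have h1 := contMDiffOn_symm_of_mem_maximalAtlas he
  have h2 := contMDiffOn_of_mem_maximalAtlas he'
  exact h2.comp (h1.mono fun y hy => by simp at hy; exact hy.1) fun y hy => by
    simp at hy; exact hy.2

theorem contDiffOn_comp_symm {e : OpenPartialHomeomorph M (Coord n)}
    (he : e ∈ smoothCharts n M) {u : M → ℝ} {k : ℕ∞ω} (hk : k ≤ ∞)
    (hu : ContMDiff (𝓡 n) 𝓘(ℝ, ℝ) k u) : ContDiffOn ℝ k (u ∘ e.symm) e.target := by
  rw [← contMDiffOn_iff_contDiffOn]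
  exact hu.comp_contMDiffOn ((contMDiffOn_symm_of_mem_maximalAtlas he).of_le hk)

variable (n M) in
/-- A family of smooth charts with compactly supported bump functions on their targets, such that
the sets where these are identically one cover the manifold. -/
structure BumpCover (ι : Type*) where
  chart : ι → OpenPartialHomeomorph M (Coord n)
  chart_mem : ∀ i, chart i ∈ smoothCharts n M
  bump : ι → Coord n → ℝ
  core : ι → Set (Coord n)
  contDiff_bump : ∀ i, ContDiff ℝ ∞ (bump i)
  bump_nonneg : ∀ i y, 0 ≤ bump i y
  hasCompactSupport : ∀ i, HasCompactSupport (bump i)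
  tsupport_subset : ∀ i, tsupport (bump i) ⊆ (chart i).target
  isCompact_core : ∀ i, IsCompact (core i)
  core_subset : ∀ i, core i ⊆ tsupport (bump i)
  bump_eq_one : ∀ i, ∀ y ∈ core i, bump i y = 1
  exists_mem_core : ∀ x : M, ∃ i, x ∈ (chart i).source ∧ chart i x ∈ core i

variable (n M) in
-- Each chart target contains a closed ball of radius `2r` about the image of the centre. The bump
-- equals one on the concentric ball of radius `r` and is supported in the larger one; by
-- compactness, finitely many preimages of the smaller balls cover `M`.
theorem exists_bumpCover [IsManifold (𝓡 n) ∞ M] [CompactSpace M] :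
    ∃ s : Finset M, Nonempty (BumpCover n M s) := by
  have h : ∀ x : M, ∃ r : ℝ, 0 < r ∧
      Metric.closedBall (chartAt (Coord n) x x) (2 * r) ⊆ (chartAt (Coord n) x).target := by
    intro x
    obtain ⟨r, hr, hsub⟩ := Metric.nhds_basis_closedBall.mem_iff.mp
      ((chartAt (Coord n) x).open_target.mem_nhds (mem_chart_target (Coord n) x))
    exact ⟨r / 2, by positivity, by rwa [mul_div_cancel₀ _ two_ne_zero]⟩
  choose r hr hsub using h
  let bmp : ∀ x : M, ContDiffBump (chartAt (Coord n) x x) := fun x =>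
    ⟨r x, 2 * r x, hr x, by linarith [hr x]⟩
  let U : M → Set M := fun x => (chartAt (Coord n) x).source ∩
    (chartAt (Coord n) x) ⁻¹' Metric.ball (chartAt (Coord n) x x) (r x)
  have hU : ∀ x ∈ (univ : Set M), U x ∈ 𝓝 x := fun x _ =>
    ((chartAt (Coord n) x).isOpen_inter_preimage Metric.isOpen_ball).mem_nhds
      ⟨mem_chart_source _ x, Metric.mem_ball_self (hr x)⟩
  obtain ⟨s, -, hs⟩ := isCompact_univ.elim_nhds_subcover U hU
  refine ⟨s, ⟨{
    chart := fun i => chartAt (Coord n) i.1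
    chart_mem := fun i => IsManifold.chart_mem_maximalAtlas i.1
    bump := fun i => bmp i.1
    core := fun i => Metric.closedBall (chartAt (Coord n) i.1 i.1) (r i.1)
    contDiff_bump := fun i => (bmp i.1).contDiff
    bump_nonneg := fun i y => (bmp i.1).nonneg
    hasCompactSupport := fun i => (bmp i.1).hasCompactSupport
    tsupport_subset := fun i => by rw [(bmp i.1).tsupport_eq]; exact hsub i.1
    isCompact_core := fun i => isCompact_closedBall _ _
    core_subset := fun i => by
      rw [(bmp i.1).tsupport_eq]
      exact Metric.closedBall_subset_closedBall (bmp i.1).rIn_lt_rOut.le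
    bump_eq_one := fun i y hy => (bmp i.1).one_of_mem_closedBall hy
    exists_mem_core := fun x => ?_ }⟩⟩
  obtain ⟨i, hi, hx⟩ := mem_iUnion₂.mp (hs (mem_univ x))
  exact ⟨⟨i, hi⟩, hx.1, Metric.ball_subset_closedBall hx.2⟩

namespace BumpCover

variable {ι : Type*} (𝒞 : BumpCover n M ι)

/-- The part of `M` where both the `i`-th bump function is supported and the `j`-th one is
identically one. -/
def overlap (i j : ι) : Set M :=
  ((𝒞.chart i).symm '' tsupport (𝒞.bump i)) ∩ ((𝒞.chart j).symm '' 𝒞.core j)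

theorem core_subset_target (j : ι) : 𝒞.core j ⊆ (𝒞.chart j).target :=
  (𝒞.core_subset j).trans (𝒞.tsupport_subset j)

theorem isCompact_overlap [T2Space M] (i j : ι) : IsCompact (𝒞.overlap i j) := by
  refine IsCompact.inter ?_ ?_
  · exact (𝒞.hasCompactSupport i).isCompact.image_of_continuousOn
      ((𝒞.chart i).continuousOn_symm.mono (𝒞.tsupport_subset i))
  · exact (𝒞.isCompact_core j).image_of_continuousOn
      ((𝒞.chart j).continuousOn_symm.mono (𝒞.core_subset_target j))

theorem overlap_subset_source (i j : ι) : 𝒞.overlap i j ⊆ (𝒞.chart i).source := by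
  rintro x ⟨⟨y, hy, rfl⟩, -⟩
  exact (𝒞.chart i).map_target (𝒞.tsupport_subset i hy)

theorem overlap_subset_source' (i j : ι) : 𝒞.overlap i j ⊆ (𝒞.chart j).source := by
  rintro x ⟨-, ⟨y, hy, rfl⟩⟩
  exact (𝒞.chart j).map_target (𝒞.core_subset_target j hy)

theorem isCompact_image_overlap [T2Space M] (i j : ι) :
    IsCompact (𝒞.chart i '' 𝒞.overlap i j) :=
  (𝒞.isCompact_overlap i j).image_of_continuousOn
    ((𝒞.chart i).continuousOn.mono (𝒞.overlap_subset_source i j))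

theorem isCompact_image_overlap' [T2Space M] (i j : ι) :
    IsCompact (𝒞.chart j '' 𝒞.overlap i j) :=
  (𝒞.isCompact_overlap i j).image_of_continuousOn
    ((𝒞.chart j).continuousOn.mono (𝒞.overlap_subset_source' i j))

theorem image_overlap_subset (i j : ι) :
    𝒞.chart i '' 𝒞.overlap i j ⊆ tsupport (𝒞.bump i) := by
  rintro _ ⟨_, ⟨⟨y, hy, rfl⟩, -⟩, rfl⟩
  rwa [(𝒞.chart i).right_inv (𝒞.tsupport_subset i hy)]

theorem image_overlap_subset_core (i j : ι) :
    𝒞.chart j '' 𝒞.overlap i j ⊆ 𝒞.core j := by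
  rintro _ ⟨_, ⟨-, ⟨y, hy, rfl⟩⟩, rfl⟩
  rwa [(𝒞.chart j).right_inv (𝒞.core_subset_target j hy)]

theorem tsupport_subset_iUnion (i : ι) :
    tsupport (𝒞.bump i) ⊆ ⋃ j, 𝒞.chart i '' 𝒞.overlap i j := by
  intro y hy
  have hy' := 𝒞.tsupport_subset i hy
  obtain ⟨j, hj, hc⟩ := 𝒞.exists_mem_core ((𝒞.chart i).symm y)
  refine mem_iUnion.mpr ⟨j, (𝒞.chart i).symm y, ⟨⟨y, hy, rfl⟩, ⟨_, hc, ?_⟩⟩, ?_⟩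
  · exact (𝒞.chart j).left_inv hj
  · exact (𝒞.chart i).right_inv hy'

/-- Every point of `M` lies in some core, so the overlaps cover the support of the `i`-th bump, and
a nonnegative `F` is at most the sum of its restrictions to them. -/
theorem setIntegral_le_sum [T2Space M] [Fintype ι] (i : ι) {F : Coord n → ℝ}
    (hF : IntegrableOn F (tsupport (𝒞.bump i))) (hF0 : ∀ y, 0 ≤ F y) :
    ∫ y in tsupport (𝒞.bump i), F y ≤ ∑ j, ∫ y in 𝒞.chart i '' 𝒞.overlap i j, F y := by
  have hm : ∀ j, MeasurableSet (𝒞.chart i '' 𝒞.overlap i j) := fun j =>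
    (𝒞.isCompact_image_overlap i j).measurableSet
  have h1 : ∀ j, ∫ y in 𝒞.chart i '' 𝒞.overlap i j, F y
      = ∫ y in tsupport (𝒞.bump i), (𝒞.chart i '' 𝒞.overlap i j).indicator F y := by
    intro j
    rw [setIntegral_indicator (hm j), inter_eq_right.mpr (𝒞.image_overlap_subset i j)]
  simp only [h1]
  have hi : ∀ j, IntegrableOn ((𝒞.chart i '' 𝒞.overlap i j).indicator F)
      (tsupport (𝒞.bump i)) := fun j => Integrable.indicator hF (hm j)
  rw [← integral_finsetSum _ fun j _ => hi j]
  refine setIntegral_mono_on hF (integrable_finsetSum _ fun j _ => hi j)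
    (isClosed_tsupport _).measurableSet fun y hy => ?_
  obtain ⟨j, hj⟩ := mem_iUnion.mp (𝒞.tsupport_subset_iUnion i hy)
  calc F y = (𝒞.chart i '' 𝒞.overlap i j).indicator F y := (indicator_of_mem hj F).symm
    _ ≤ _ := Finset.single_le_sum
      (f := fun j => (𝒞.chart i '' 𝒞.overlap i j).indicator F y)
      (fun j _ => indicator_nonneg (fun y _ => hF0 y) y) (Finset.mem_univ j)

/-- The coordinate change from the `j`-th chart to the `i`-th one. -/
def transition (i j : ι) (y : Coord n) : Coord n := 𝒞.chart i ((𝒞.chart j).symm y)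

theorem transition_apply {i j : ι} {x : M} (hx : x ∈ 𝒞.overlap i j) :
    𝒞.transition i j (𝒞.chart j x) = 𝒞.chart i x := by
  rw [transition, (𝒞.chart j).left_inv (𝒞.overlap_subset_source' i j hx)]

theorem image_overlap_subset_transition_source (i j : ι) :
    𝒞.chart j '' 𝒞.overlap i j ⊆ ((𝒞.chart j).symm ≫ₕ 𝒞.chart i).source := by
  rintro _ ⟨x, hx, rfl⟩
  have h1 := 𝒞.overlap_subset_source' i j hx
  simp [(𝒞.chart j).left_inv h1, (𝒞.chart j).map_source h1, 𝒞.overlap_subset_source i j hx]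

theorem transition_image (i j : ι) :
    𝒞.transition i j '' (𝒞.chart j '' 𝒞.overlap i j) = 𝒞.chart i '' 𝒞.overlap i j := by
  rw [image_image]
  exact image_congr fun x hx => 𝒞.transition_apply hx

theorem injOn_transition (i j : ι) :
    InjOn (𝒞.transition i j) (𝒞.chart j '' 𝒞.overlap i j) := by
  rintro _ ⟨x, hx, rfl⟩ _ ⟨x', hx', rfl⟩ h
  rw [𝒞.transition_apply hx, 𝒞.transition_apply hx'] at h
  rw [(𝒞.chart i).injOn (𝒞.overlap_subset_source i j hx) (𝒞.overlap_subset_source i j hx') h]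

theorem contDiffOn_transition (i j : ι) :
    ContDiffOn ℝ ∞ (𝒞.transition i j) ((𝒞.chart j).symm ≫ₕ 𝒞.chart i).source :=
  ConformalRicci.contDiffOn_transition (𝒞.chart_mem j) (𝒞.chart_mem i)

theorem continuousOn_fderiv_transition (i j : ι) :
    ContinuousOn (fderiv ℝ (𝒞.transition i j)) ((𝒞.chart j).symm ≫ₕ 𝒞.chart i).source :=
  (𝒞.contDiffOn_transition i j).continuousOn_fderiv_of_isOpen
    ((𝒞.chart j).symm ≫ₕ 𝒞.chart i).open_source (by simp)

theorem hasFDerivAt_transition (i j : ι) {y : Coord n}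
    (hy : y ∈ ((𝒞.chart j).symm ≫ₕ 𝒞.chart i).source) :
    HasFDerivAt (𝒞.transition i j) (fderiv ℝ (𝒞.transition i j) y) y :=
  (((𝒞.contDiffOn_transition i j).contDiffAt
    (((𝒞.chart j).symm ≫ₕ 𝒞.chart i).open_source.mem_nhds hy)).differentiableAt
      (by simp)).hasFDerivAt

/-- Comparison of the Lebesgue measures of two charts on the overlap. -/
theorem exists_setIntegral_overlap_le [T2Space M] (i j : ι) :
    ∃ C : ℝ, 0 ≤ C ∧ ∀ F G : Coord n → ℝ, (∀ y, 0 ≤ G y) →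
      IntegrableOn F (tsupport (𝒞.bump i)) → ContinuousOn G (tsupport (𝒞.bump j)) →
      (∀ x ∈ 𝒞.overlap i j, F (𝒞.chart i x) ≤ G (𝒞.chart j x)) →
      ∫ y in 𝒞.chart i '' 𝒞.overlap i j, F y
        ≤ C * ∫ y in tsupport (𝒞.bump j), 𝒞.bump j y * G y := by
  have hsub := 𝒞.image_overlap_subset_transition_source i j
  have hK := 𝒞.isCompact_image_overlap' i j
  have hBj : 𝒞.chart j '' 𝒞.overlap i j ⊆ tsupport (𝒞.bump j) :=
    (𝒞.image_overlap_subset_core i j).trans (𝒞.core_subset j)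
  have hdet : ContinuousOn (fun y => |(fderiv ℝ (𝒞.transition i j) y).det|)
      (𝒞.chart j '' 𝒞.overlap i j) :=
    (ContinuousLinearMap.continuous_det.comp_continuousOn
      ((𝒞.continuousOn_fderiv_transition i j).mono hsub)).abs
  obtain ⟨C, hC⟩ := hK.exists_bound_of_continuousOn hdet
  have hder : ∀ y ∈ 𝒞.chart j '' 𝒞.overlap i j, HasFDerivWithinAt (𝒞.transition i j)
      (fderiv ℝ (𝒞.transition i j) y) (𝒞.chart j '' 𝒞.overlap i j) y := fun y hy =>
    (𝒞.hasFDerivAt_transition i j (hsub hy)).hasFDerivWithinAt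
  refine ⟨max C 0, le_max_right _ _, fun F G hG hFi hGc hFG => ?_⟩
  have hbG : ContinuousOn (fun y => 𝒞.bump j y * G y) (tsupport (𝒞.bump j)) :=
    (𝒞.contDiff_bump j).continuous.continuousOn.mul hGc
  have hbGi := hbG.integrableOn_compact (μ := volume) (𝒞.hasCompactSupport j).isCompact
  have hFi' := hFi.mono_set (𝒞.image_overlap_subset i j)
  rw [← 𝒞.transition_image] at hFi' ⊢
  rw [integral_image_eq_integral_abs_det_fderiv_smul volume hK.measurableSet hder
    (𝒞.injOn_transition i j)]
  rw [integrableOn_image_iff_integrableOn_abs_det_fderiv_smul volume hK.measurableSet hder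
    (𝒞.injOn_transition i j)] at hFi'
  -- After the change of variables, the overlap lies in the `j`-th core, where the bump equals one.
  -- Inserting it as a weight costs nothing, and only the Jacobian must be bounded.
  calc _ ≤ ∫ y in 𝒞.chart j '' 𝒞.overlap i j, max C 0 * (𝒞.bump j y * G y) := by
        refine setIntegral_mono_on hFi' ((hbGi.mono_set hBj).const_mul _) hK.measurableSet ?_
        rintro y hy
        have h1 : |(fderiv ℝ (𝒞.transition i j) y).det| ≤ max C 0 := by
          have := hC y hy
          rw [Real.norm_eq_abs, abs_abs] at this
          exact this.trans (le_max_left _ _)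
        obtain ⟨x, hx, rfl⟩ := hy
        rw [𝒞.bump_eq_one j _ (𝒞.image_overlap_subset_core i j ⟨x, hx, rfl⟩), one_mul,
          smul_eq_mul, 𝒞.transition_apply hx]
        calc _ ≤ |(fderiv ℝ (𝒞.transition i j) (𝒞.chart j x)).det| * G (𝒞.chart j x) :=
              mul_le_mul_of_nonneg_left (hFG x hx) (abs_nonneg _)
          _ ≤ _ := mul_le_mul_of_nonneg_right h1 (hG _)
    _ = max C 0 * ∫ y in 𝒞.chart j '' 𝒞.overlap i j, 𝒞.bump j y * G y :=
        integral_const_mul _ _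
    _ ≤ _ := by
        refine mul_le_mul_of_nonneg_left ?_ (le_max_right _ _)
        exact setIntegral_mono_set hbGi
          (Eventually.of_forall fun y => mul_nonneg (𝒞.bump_nonneg j y) (hG y))
          (LE.le.eventuallyLE hBj)

/-- The sum of local `L¹` norms over the supports of the bump functions is dominated by the sum
of the integrals weighted with the bump functions. -/
theorem exists_sum_setIntegral_le [T2Space M] [Fintype ι] (c : ι → ι → ℝ) (hc : ∀ i j, 0 ≤ c i j) :
    ∃ C : ℝ, 0 ≤ C ∧ ∀ F : ι → Coord n → ℝ, (∀ i y, 0 ≤ F i y) →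
      (∀ i, ContinuousOn (F i) (tsupport (𝒞.bump i))) →
      (∀ i j, ∀ x ∈ 𝒞.overlap i j, F i (𝒞.chart i x) ≤ c i j * F j (𝒞.chart j x)) →
      ∑ i, ∫ y in tsupport (𝒞.bump i), F i y
        ≤ C * ∑ j, ∫ y in tsupport (𝒞.bump j), 𝒞.bump j y * F j y := by
  choose C hC0 hC using 𝒞.exists_setIntegral_overlap_le
  refine ⟨∑ i, ∑ j, C i j * c i j, Finset.sum_nonneg fun i _ => Finset.sum_nonneg fun j _ =>
    mul_nonneg (hC0 i j) (hc i j), fun F hF0 hFc hF => ?_⟩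
  have hi : ∀ i, IntegrableOn (F i) (tsupport (𝒞.bump i)) := fun i =>
    (hFc i).integrableOn_compact (𝒞.hasCompactSupport i).isCompact
  have hnn : ∀ j, 0 ≤ ∫ y in tsupport (𝒞.bump j), 𝒞.bump j y * F j y := fun j =>
    integral_nonneg fun y => mul_nonneg (𝒞.bump_nonneg j y) (hF0 j y)
  rw [Finset.sum_mul]
  refine Finset.sum_le_sum fun i _ => (𝒞.setIntegral_le_sum i (hi i) (hF0 i)).trans ?_
  rw [Finset.sum_mul]
  refine Finset.sum_le_sum fun j _ => ?_
  calc _ ≤ C i j * ∫ y in tsupport (𝒞.bump j), 𝒞.bump j y * (c i j * F j y) :=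
        hC i j (F i) (fun y => c i j * F j y) (fun y => mul_nonneg (hc i j) (hF0 j y)) (hi i)
          (continuousOn_const.mul (hFc j)) (hF i j)
    _ = C i j * c i j * ∫ y in tsupport (𝒞.bump j), 𝒞.bump j y * F j y := by
        rw [← integral_const_mul, ← integral_const_mul]
        exact integral_congr_ae (Eventually.of_forall fun y => by ring)
    _ ≤ _ := mul_le_mul_of_nonneg_left
        (Finset.single_le_sum (fun j _ => hnn j) (Finset.mem_univ j))
        (mul_nonneg (hC0 i j) (hc i j))

end BumpCover

/-! ### Comparison of coordinate gradients. -/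

/-- The Euclidean squared norm of the coordinate gradient. -/
noncomputable def gradSq {n : ℕ} (u : Coord n → ℝ) (y : Coord n) : ℝ := ∑ a, partialDeriv a u y ^ 2

theorem gradSq_nonneg {n : ℕ} (u : Coord n → ℝ) (y : Coord n) : 0 ≤ gradSq u y :=
  Finset.sum_nonneg fun _ _ => sq_nonneg _

theorem norm_fderiv_sq_le_gradSq {n : ℕ} (u : Coord n → ℝ) (y : Coord n) :
    ‖fderiv ℝ u y‖ ^ 2 ≤ gradSq u y := by
  have h : ‖fderiv ℝ u y‖ ≤ √(gradSq u y) := by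
    refine ContinuousLinearMap.opNorm_le_bound _ (Real.sqrt_nonneg _) fun ξ => ?_
    have hξ : fderiv ℝ u y ξ = ∑ a, partialDeriv a u y * ξ a := by
      conv_lhs => rw [← (EuclideanSpace.basisFun (Fin n) ℝ).sum_repr ξ]
      simp [partialDeriv, mul_comm]
    rw [hξ, EuclideanSpace.norm_eq, ← Real.sqrt_mul (gradSq_nonneg u y), Real.norm_eq_abs]
    refine Real.abs_le_sqrt ((Finset.sum_mul_sq_le_sq_mul_sq _ _ _).trans_eq ?_)
    simp [gradSq]
  calc _ ≤ √(gradSq u y) ^ 2 := by gcongr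
    _ = _ := Real.sq_sqrt (gradSq_nonneg u y)

theorem gradSq_le {n : ℕ} (u : Coord n → ℝ) (y : Coord n) :
    gradSq u y ≤ n * ‖fderiv ℝ u y‖ ^ 2 := by
  have h : ∀ a, partialDeriv a u y ^ 2 ≤ ‖fderiv ℝ u y‖ ^ 2 := by
    intro a
    rw [sq_le_sq, abs_of_nonneg (norm_nonneg (fderiv ℝ u y))]
    simpa [partialDeriv] using (fderiv ℝ u y).le_opNorm (EuclideanSpace.single a 1)
  calc _ ≤ ∑ _a : Fin n, ‖fderiv ℝ u y‖ ^ 2 := Finset.sum_le_sum fun a _ => h a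
    _ = _ := by simp

namespace BumpCover

variable {ι : Type*} (𝒞 : BumpCover n M ι)

/-- By the chain rule the two coordinate gradients differ by the derivative of the transition map,
which is bounded on the compact overlap independently of `w`. -/
theorem exists_gradSq_overlap_le [T2Space M] (i j : ι) :
    ∃ C : ℝ, 0 ≤ C ∧ ∀ w : M → ℝ, ContMDiff (𝓡 n) 𝓘(ℝ, ℝ) 2 w → ∀ x ∈ 𝒞.overlap i j,
      gradSq (w ∘ (𝒞.chart i).symm) (𝒞.chart i x)
        ≤ C * gradSq (w ∘ (𝒞.chart j).symm) (𝒞.chart j x) := by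
  have hsub : 𝒞.chart i '' 𝒞.overlap i j ⊆ ((𝒞.chart i).symm ≫ₕ 𝒞.chart j).source := by
    rintro _ ⟨x, hx, rfl⟩
    have h1 := 𝒞.overlap_subset_source i j hx
    simp [(𝒞.chart i).left_inv h1, (𝒞.chart i).map_source h1, 𝒞.overlap_subset_source' i j hx]
  obtain ⟨C, hC⟩ := (𝒞.isCompact_image_overlap i j).exists_bound_of_continuousOn
    ((𝒞.continuousOn_fderiv_transition j i).mono hsub)
  refine ⟨n * C ^ 2, by positivity, fun w hw x hx => ?_⟩
  set y := 𝒞.chart i x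
  have hy : y ∈ 𝒞.chart i '' 𝒞.overlap i j := ⟨x, hx, rfl⟩
  have hxj := 𝒞.overlap_subset_source' i j hx
  have hxi := 𝒞.overlap_subset_source i j hx
  have hτ : 𝒞.transition j i y = 𝒞.chart j x := by
    simp [transition, y, (𝒞.chart i).left_inv hxi]
  have hwd : DifferentiableAt ℝ (w ∘ (𝒞.chart j).symm) (𝒞.transition j i y) := by
    rw [hτ]
    exact ((contDiffOn_comp_symm (𝒞.chart_mem j) two_le_infty hw).contDiffAt
      ((𝒞.chart j).open_target.mem_nhds ((𝒞.chart j).map_source hxj))).differentiableAt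
        two_ne_zero
  have hEq : w ∘ (𝒞.chart i).symm =ᶠ[𝓝 y] (w ∘ (𝒞.chart j).symm) ∘ 𝒞.transition j i := by
    filter_upwards [((𝒞.chart i).symm ≫ₕ 𝒞.chart j).open_source.mem_nhds (hsub hy)] with z hz
    simp at hz
    simp [transition, (𝒞.chart j).left_inv hz.2]
  have hd : fderiv ℝ (w ∘ (𝒞.chart i).symm) y
      = (fderiv ℝ (w ∘ (𝒞.chart j).symm) (𝒞.chart j x)).comp
        (fderiv ℝ (𝒞.transition j i) y) := by
    rw [hEq.fderiv_eq, fderiv_comp y hwd (𝒞.hasFDerivAt_transition j i (hsub hy)).differentiableAt,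
      hτ]
  calc _ ≤ n * ‖fderiv ℝ (w ∘ (𝒞.chart i).symm) y‖ ^ 2 := gradSq_le _ _
    _ ≤ n * (‖fderiv ℝ (w ∘ (𝒞.chart j).symm) (𝒞.chart j x)‖ * C) ^ 2 := by
        rw [hd]
        gcongr
        exact (ContinuousLinearMap.opNorm_comp_le _ _).trans
          (mul_le_mul_of_nonneg_left (hC y hy) (norm_nonneg _))
    _ = n * C ^ 2 * ‖fderiv ℝ (w ∘ (𝒞.chart j).symm) (𝒞.chart j x)‖ ^ 2 := by ring
    _ ≤ _ := mul_le_mul_of_nonneg_left (norm_fderiv_sq_le_gradSq _ _) (by positivity)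

theorem exists_sum_setIntegral_sq_le [T2Space M] [Fintype ι] :
    ∃ C : ℝ, 0 < C ∧ ∀ u : M → ℝ, (∀ i, ContinuousOn (u ∘ (𝒞.chart i).symm) (𝒞.chart i).target) →
      ∑ i, ∫ y in tsupport (𝒞.bump i), u ((𝒞.chart i).symm y) ^ 2
        ≤ C * ∑ i, ∫ y in tsupport (𝒞.bump i), 𝒞.bump i y * u ((𝒞.chart i).symm y) ^ 2 := by
  obtain ⟨C, hC0, hC⟩ := 𝒞.exists_sum_setIntegral_le (fun _ _ => 1) fun _ _ => zero_le_one
  -- Adding `1` makes the constant strictly positive, so that it can serve as a divisor in the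
  -- choice of `ε` in `exists_defectForm_le`.
  refine ⟨C + 1, by positivity, fun u hu => ?_⟩
  refine (hC (fun i y => u ((𝒞.chart i).symm y) ^ 2) (fun i y => sq_nonneg _)
    (fun i => ((hu i).mono (𝒞.tsupport_subset i)).pow 2) fun i j x hx => ?_).trans ?_
  · rw [(𝒞.chart i).left_inv (𝒞.overlap_subset_source i j hx),
      (𝒞.chart j).left_inv (𝒞.overlap_subset_source' i j hx), one_mul]
  · refine mul_le_mul_of_nonneg_right (by linarith) (Finset.sum_nonneg fun i _ =>
      integral_nonneg fun y => mul_nonneg (𝒞.bump_nonneg i y) (sq_nonneg _))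

theorem exists_sum_setIntegral_gradSq_le [T2Space M] [Fintype ι] :
    ∃ C : ℝ, 0 ≤ C ∧ ∀ w : M → ℝ, ContMDiff (𝓡 n) 𝓘(ℝ, ℝ) 2 w →
      ∑ i, ∫ y in tsupport (𝒞.bump i), gradSq (w ∘ (𝒞.chart i).symm) y
        ≤ C * ∑ i, ∫ y in tsupport (𝒞.bump i),
          𝒞.bump i y * gradSq (w ∘ (𝒞.chart i).symm) y := by
  choose c hc0 hc using 𝒞.exists_gradSq_overlap_le
  obtain ⟨C, hC0, hC⟩ := 𝒞.exists_sum_setIntegral_le c hc0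
  refine ⟨C, hC0, fun w hw => hC (fun i => gradSq (w ∘ (𝒞.chart i).symm))
    (fun i y => gradSq_nonneg _ _) (fun i => ?_) fun i j x hx => hc i j w hw x hx⟩
  have h2 := contDiffOn_comp_symm (𝒞.chart_mem i) two_le_infty hw
  have := fun a => (contDiffOn_partialDeriv (k := 0) (𝒞.chart i).open_target h2
    (by norm_num) a).continuousOn.mono (𝒞.tsupport_subset i)
  unfold gradSq
  fun_prop

end BumpCover

end Charts

/-! ### Time and space derivatives of jointly differentiable functions. -/

section Slices

variable {n : ℕ} {Ω : Set (ℝ × Coord n)} {F : ℝ × Coord n → ℝ}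

theorem hasDerivAt_time_slice (hΩ : IsOpen Ω) (hF : ContDiffOn ℝ 1 F Ω) {t : ℝ} {y : Coord n}
    (hz : (t, y) ∈ Ω) : HasDerivAt (fun s => F (s, y)) (fderiv ℝ F (t, y) (1, 0)) t := by
  have h := ((hF.contDiffAt (hΩ.mem_nhds hz)).differentiableAt one_ne_zero).hasFDerivAt
  exact h.comp_hasDerivAt t ((hasDerivAt_id t).prodMk (hasDerivAt_const t y))

theorem partialDeriv_space_slice (hΩ : IsOpen Ω) (hF : ContDiffOn ℝ 1 F Ω) {t : ℝ} {y : Coord n}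
    (hz : (t, y) ∈ Ω) (a : Fin n) : partialDeriv a (fun x => F (t, x)) y
      = fderiv ℝ F (t, y) (0, EuclideanSpace.single a 1) := by
  have h := ((hF.contDiffAt (hΩ.mem_nhds hz)).differentiableAt one_ne_zero).hasFDerivAt
  have h2 := h.comp y ((hasFDerivAt_const t y).prodMk (hasFDerivAt_id y))
  have h3 : HasFDerivAt (fun x => F (t, x)) _ y := h2
  rw [partialDeriv, h3.fderiv]
  simp

theorem continuousOn_deriv_time_slice (hΩ : IsOpen Ω) (hF : ContDiffOn ℝ 1 F Ω) :
    ContinuousOn (fun z : ℝ × Coord n => deriv (fun s => F (s, z.2)) z.1) Ω := by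
  refine ContinuousOn.congr (f := fun z => fderiv ℝ F z (1, 0)) ?_ fun z hz =>
    (hasDerivAt_time_slice hΩ hF hz).deriv
  exact (hF.continuousOn_fderiv_of_isOpen hΩ le_rfl).clm_apply continuousOn_const

theorem continuousOn_partialDeriv_slice (hΩ : IsOpen Ω) (hF : ContDiffOn ℝ 1 F Ω) (a : Fin n) :
    ContinuousOn (fun z : ℝ × Coord n => partialDeriv a (fun x => F (z.1, x)) z.2) Ω := by
  refine ContinuousOn.congr (f := fun z => fderiv ℝ F z (0, EuclideanSpace.single a 1)) ?_
    fun z hz => partialDeriv_space_slice hΩ hF hz a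
  exact (hF.continuousOn_fderiv_of_isOpen hΩ le_rfl).clm_apply continuousOn_const

end Slices

/-! ### Local parabolic solutions and the time derivatives of their mass and energy. -/

/-- `V` is a classical solution on `J × U` of the parabolic equation
`∂_t V = A^{ab} ∂_a ∂_b V + q^a ∂_a V + c V`, with `c` a bounded function of time. -/
structure IsLocalSolution {n : ℕ} (U : Set (Coord n)) (J : Set ℝ)
    (A : ℝ → Fin n → Fin n → Coord n → ℝ) (q : ℝ → Fin n → Coord n → ℝ) (c : ℝ → ℝ)
    (V : ℝ → Coord n → ℝ) : Prop where
  contDiffOn_coeff : ∀ a b, ContDiffOn ℝ 1 (fun z : ℝ × Coord n => A z.1 a b z.2) (J ×ˢ U)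
  symm : ∀ t ∈ J, ∀ y ∈ U, ∀ a b, A t a b y = A t b a y
  pos : ∀ t ∈ J, ∀ y ∈ U, ∀ ξ : Fin n → ℝ, ξ ≠ 0 → 0 < ∑ a, ∑ b, A t a b y * ξ a * ξ b
  continuousOn_drift : ∀ a, ContinuousOn (fun z : ℝ × Coord n => q z.1 a z.2) (J ×ˢ U)
  bounded : ∃ C, ∀ t ∈ J, |c t| ≤ C
  contDiffOn : ∀ t ∈ J, ContDiffOn ℝ 2 (V t) U
  continuousOn : ContinuousOn (fun z : ℝ × Coord n => V z.1 z.2) (J ×ˢ U)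
  continuousOn_deriv : ∀ a,
    ContinuousOn (fun z : ℝ × Coord n => partialDeriv a (V z.1) z.2) (J ×ˢ U)
  continuousOn_deriv_deriv : ∀ a b,
    ContinuousOn (fun z : ℝ × Coord n => partialDeriv a (partialDeriv b (V z.1)) z.2) (J ×ˢ U)
  hasDerivAt : ∀ t ∈ J, ∀ y ∈ U,
    HasDerivAt (fun s => V s y) (ellipticOp (A t) (q t) (V t) y + c t * V t y) t

theorem continuousOn_slice {X Y : Type*} [TopologicalSpace X] [TopologicalSpace Y] {F : X → Y → ℝ}
    {J : Set X} {U : Set Y} (hF : ContinuousOn (fun z : X × Y => F z.1 z.2) (J ×ˢ U)) {t : X}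
    (ht : t ∈ J) : ContinuousOn (F t) U :=
  hF.comp (f := fun y => (t, y)) (by fun_prop) fun _ hy => ⟨ht, hy⟩

theorem continuousOn_freeze {X Y : Type*} [TopologicalSpace X] [TopologicalSpace Y] {F : Y → ℝ}
    {S : Set X} {U : Set Y} (hF : ContinuousOn F U) :
    ContinuousOn (fun z : X × Y => F z.2) (S ×ˢ U) :=
  hF.comp (by fun_prop) fun _ hz => hz.2

namespace IsLocalSolution

variable {n : ℕ} {U : Set (Coord n)} {J : Set ℝ} {A : ℝ → Fin n → Fin n → Coord n → ℝ}
  {q : ℝ → Fin n → Coord n → ℝ} {c : ℝ → ℝ} {V : ℝ → Coord n → ℝ} {ψ : Coord n → ℝ}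

theorem continuousOn_ellipticOp (h : IsLocalSolution U J A q c V) :
    ContinuousOn (fun z : ℝ × Coord n => ellipticOp (A z.1) (q z.1) (V z.1) z.2) (J ×ˢ U) := by
  have h1 := fun a b => (h.contDiffOn_coeff a b).continuousOn
  have h2 := h.continuousOn_drift
  have h3 := h.continuousOn_deriv
  have h4 := h.continuousOn_deriv_deriv
  unfold ellipticOp
  fun_prop

theorem continuousOn_defect (h : IsLocalSolution U J A q c V) (hJ : IsOpen J) (hU : IsOpen U)
    (hψ : ContDiff ℝ 1 ψ) (b : Fin n) :
    ContinuousOn (fun z : ℝ × Coord n => defect ψ (A z.1) (q z.1) b z.2) (J ×ˢ U) := by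
  have h1 := fun a b => (h.contDiffOn_coeff a b).continuousOn
  have h2 := h.continuousOn_drift
  have h3 : ∀ a b c, ContinuousOn (fun z : ℝ × Coord n => partialDeriv c (A z.1 a b) z.2)
      (J ×ˢ U) := fun a b c =>
    continuousOn_partialDeriv_slice (hJ.prod hU) (h.contDiffOn_coeff a b) c
  have h4 : ContinuousOn (fun z : ℝ × Coord n => ψ z.2) (J ×ˢ U) :=
    continuousOn_freeze hψ.continuous.continuousOn
  have h5 : ∀ a, ContinuousOn (fun z : ℝ × Coord n => partialDeriv a ψ z.2) (J ×ˢ U) := fun a =>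
    continuousOn_freeze ((contDiffOn_partialDeriv (k := 0) isOpen_univ (contDiffOn_univ.mpr hψ)
      (by norm_num) a).continuousOn.mono (subset_univ _))
  exact (continuousOn_finsetSum _ fun a _ => ((h5 a).mul (h1 a b)).add (h4.mul (h3 a b a))).sub
    (h4.mul (h2 b))

theorem continuousOn_deriv_coeff (h : IsLocalSolution U J A q c V) (hJ : IsOpen J)
    (hU : IsOpen U) (a b : Fin n) :
    ContinuousOn (fun z : ℝ × Coord n => deriv (fun s => A s a b z.2) z.1) (J ×ˢ U) :=
  continuousOn_deriv_time_slice (hJ.prod hU) (h.contDiffOn_coeff a b)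

theorem hasDerivAt_coeff (h : IsLocalSolution U J A q c V) (hJ : IsOpen J)
    (hU : IsOpen U) {t : ℝ} (ht : t ∈ J) {y : Coord n} (hy : y ∈ U) (a b : Fin n) :
    HasDerivAt (fun s => A s a b y) (deriv (fun s => A s a b y) t) t :=
  (hasDerivAt_time_slice (hJ.prod hU) (h.contDiffOn_coeff a b) ⟨ht, hy⟩).differentiableAt.hasDerivAt

theorem contDiffOn_coeff_slice (h : IsLocalSolution U J A q c V) {t : ℝ} (ht : t ∈ J)
    (a b : Fin n) : ContDiffOn ℝ 1 (A t a b) U :=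
  (h.contDiffOn_coeff a b).comp (f := fun y => (t, y)) (by fun_prop) fun _ hy => ⟨ht, hy⟩

/-- Differentiation at time `t` of an integral of `(V s - V t) r s`. -/
theorem hasDerivAt_setIntegral_sub_mul (h : IsLocalSolution U J A q c V) (hJ : IsOpen J)
    {K : Set (Coord n)} (hK : IsCompact K) (hKU : K ⊆ U) {t : ℝ} (ht : t ∈ J)
    {r : ℝ → Coord n → ℝ} (hr : ContinuousOn (fun z : ℝ × Coord n => r z.1 z.2) (J ×ˢ K)) :
    HasDerivAt (fun s => ∫ y in K, (V s y - V t y) * r s y)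
      (∫ y in K, (ellipticOp (A t) (q t) (V t) y + c t * V t y) * r t y) t := by
  obtain ⟨ε, hε, hsub⟩ := Metric.nhds_basis_closedBall.mem_iff.mp (hJ.mem_nhds ht)
  rw [Real.closedBall_eq_Icc] at hsub
  have hsub2 : Icc (t - ε) (t + ε) ×ˢ K ⊆ J ×ˢ U := prod_mono hsub hKU
  obtain ⟨C₀, hC₀⟩ := h.bounded
  obtain ⟨C₁, hC₁⟩ := (isCompact_Icc.prod hK).exists_bound_of_continuousOn
    (h.continuousOn_ellipticOp.mono hsub2)
  obtain ⟨C₂, hC₂⟩ := (isCompact_Icc.prod hK).exists_bound_of_continuousOn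
    (h.continuousOn.mono hsub2)
  refine ConformalRicci.hasDerivAt_setIntegral_sub_mul hK
    (Q' := fun s y => ellipticOp (A s) (q s) (V s) y + c s * V s y) (C := C₁ + C₀ * C₂) hε
    (h.continuousOn.mono hsub2) (fun s hs y hy => h.hasDerivAt s (hsub hs) y (hKU hy)) ?_
    (hr.mono (prod_mono hsub le_rfl))
  intro s hs y hy
  have h1 := hC₁ (s, y) ⟨hs, hy⟩
  have h2 := hC₂ (s, y) ⟨hs, hy⟩
  have h3 := hC₀ s (hsub hs)
  rw [Real.norm_eq_abs] at h1 h2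
  refine (abs_add_le _ _).trans (add_le_add h1 ?_)
  rw [abs_mul]
  exact mul_le_mul h3 h2 (abs_nonneg _) ((abs_nonneg _).trans h3)

/-- The time derivative of the weighted local `L²` norm. -/
theorem hasDerivAt_mass (h : IsLocalSolution U J A q c V) (hJ : IsOpen J)
    (hψ : ContDiff ℝ 1 ψ) (hc : HasCompactSupport ψ) (hsupp : tsupport ψ ⊆ U) {t : ℝ}
    (ht : t ∈ J) :
    HasDerivAt (fun s => ∫ y in tsupport ψ, ψ y * V s y ^ 2)
      (2 * (∫ y in tsupport ψ, ψ y * (V t y * ellipticOp (A t) (q t) (V t) y))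
        + 2 * c t * ∫ y in tsupport ψ, ψ y * V t y ^ 2) t := by
  have hK : IsCompact (tsupport ψ) := hc
  have hV := h.continuousOn.mono (prod_mono (le_refl J) hsupp)
  have cV : ∀ s ∈ J, ContinuousOn (V s) (tsupport ψ) := fun s hs => continuousOn_slice hV hs
  have cZ := continuousOn_slice (F := fun t => ellipticOp (A t) (q t) (V t))
    (h.continuousOn_ellipticOp.mono (prod_mono (le_refl J) hsupp)) ht
  have cψ := hψ.continuous.continuousOn (s := tsupport ψ)
  have cVt := cV t ht
  have hψ2 : ContinuousOn (fun z : ℝ × Coord n => ψ z.2) (J ×ˢ tsupport ψ) :=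
    continuousOn_freeze cψ
  have hVt : ContinuousOn (fun z : ℝ × Coord n => V t z.2) (J ×ˢ tsupport ψ) :=
    continuousOn_freeze cVt
  -- The factorisation `V_s² - V_t² = (V_s - V_t)(V_s + V_t)` brings the difference of masses into
  -- the form `(V s - V t) r s`.
  have hr : ContinuousOn (fun z : ℝ × Coord n => ψ z.2 * (V z.1 z.2 + V t z.2))
      (J ×ˢ tsupport ψ) := hψ2.mul (hV.add hVt)
  have key := (h.hasDerivAt_setIntegral_sub_mul hJ hK hsupp ht
    (r := fun s y => ψ y * (V s y + V t y)) hr).add_const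
    (∫ y in tsupport ψ, ψ y * V t y ^ 2)
  have hint : ∀ {F : Coord n → ℝ}, ContinuousOn F (tsupport ψ) → IntegrableOn F (tsupport ψ) :=
    fun hF => hF.integrableOn_compact hK
  refine HasDerivAt.congr_deriv (key.congr_of_eventuallyEq ?_) ?_
  · filter_upwards [hJ.mem_nhds ht] with s hs
    have cVs := cV s hs
    rw [← integral_add (hint (by fun_prop)) (hint (by fun_prop))]
    exact integral_congr_ae (Eventually.of_forall fun y => by ring)
  · rw [← integral_const_mul, ← integral_const_mul,
      ← integral_add (hint (by fun_prop)) (hint (by fun_prop))]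
    exact integral_congr_ae (Eventually.of_forall fun y => by ring)

theorem setIntegral_gradForm (h : IsLocalSolution U J A q c V) (hU : IsOpen U)
    (hψ : ContDiff ℝ 1 ψ) (hc : HasCompactSupport ψ) (hsupp : tsupport ψ ⊆ U) {t : ℝ}
    (ht : t ∈ J) {u w : Coord n → ℝ} (hu : ContDiffOn ℝ 1 u U) (hw : ContDiffOn ℝ 2 w U) :
    ∫ y in tsupport ψ, ψ y * gradForm (A t) u w y
      = -(∫ y in tsupport ψ, ψ y * (u y * ellipticOp (A t) (q t) w y))
        - ∫ y in tsupport ψ, u y * ∑ b, defect ψ (A t) (q t) b y * partialDeriv b w y :=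
  ConformalRicci.setIntegral_gradForm hU hψ hc hsupp (h.contDiffOn_coeff_slice ht)
    (fun a => continuousOn_slice (F := fun s => q s a) (h.continuousOn_drift a) ht) hu hw

/-- A difference of squares for the form frozen at time `t`; the cross terms cancel because `A t` is
symmetric. One factor becomes `V s - V t`, from which the derivative can be moved away by parts. -/
theorem gradForm_self_sub (h : IsLocalSolution U J A q c V) (hU : IsOpen U) {s t : ℝ}
    (hs : s ∈ J) (ht : t ∈ J) {y : Coord n} (hy : y ∈ U) :
    gradForm (A t) (V s) (V s) y - gradForm (A t) (V t) (V t) y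
      = gradForm (A t) (V s - V t) (V s) y + gradForm (A t) (V s - V t) (V t) y := by
  have hd : ∀ r ∈ J, DifferentiableAt ℝ (V r) y := fun r hr =>
    ((h.contDiffOn r hr).contDiffAt (hU.mem_nhds hy)).differentiableAt two_ne_zero
  have hp : ∀ a, partialDeriv a (V s - V t) y
      = partialDeriv a (V s) y - partialDeriv a (V t) y := by
    intro a
    simp [partialDeriv, fderiv_sub (hd s hs) (hd t ht)]
  have hsym : ∑ a, ∑ b, A t a b y * partialDeriv a (V t) y * partialDeriv b (V s) y
      = ∑ a, ∑ b, A t a b y * partialDeriv a (V s) y * partialDeriv b (V t) y := by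
    rw [Finset.sum_comm]
    refine Finset.sum_congr rfl fun a _ => Finset.sum_congr rfl fun b _ => ?_
    rw [h.symm t ht y hy a b]
    ring
  simp only [gradForm, hp, mul_sub, sub_mul, Finset.sum_sub_distrib]
  linarith

/-- The time derivative of the weighted local Dirichlet energy. -/
theorem hasDerivAt_energy (h : IsLocalSolution U J A q c V) (hJ : IsOpen J) (hU : IsOpen U)
    (hψ : ContDiff ℝ 1 ψ) (hc : HasCompactSupport ψ) (hsupp : tsupport ψ ⊆ U) {t : ℝ}
    (ht : t ∈ J) :
    HasDerivAt (fun s => ∫ y in tsupport ψ, ψ y * gradForm (A s) (V s) (V s) y)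
      ((∫ y in tsupport ψ, ψ y * gradForm (fun a b y => deriv (fun s => A s a b y) t)
          (V t) (V t) y)
        - 2 * (∫ y in tsupport ψ, ψ y * ellipticOp (A t) (q t) (V t) y ^ 2)
        - 2 * (∫ y in tsupport ψ, ellipticOp (A t) (q t) (V t) y
            * ∑ b, defect ψ (A t) (q t) b y * partialDeriv b (V t) y)
        + 2 * c t * ∫ y in tsupport ψ, ψ y * gradForm (A t) (V t) (V t) y) t := by
  have hK : IsCompact (tsupport ψ) := hc
  have hsub := prod_mono (le_refl J) hsupp
  have hint : ∀ {F : Coord n → ℝ}, ContinuousOn F (tsupport ψ) → IntegrableOn F (tsupport ψ) :=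
    fun hF => hF.integrableOn_compact hK
  have hV := h.continuousOn.mono hsub
  have hV1 := fun a => (h.continuousOn_deriv a).mono hsub
  have hV2 := fun a b => (h.continuousOn_deriv_deriv a b).mono hsub
  have hA := fun a b => (h.contDiffOn_coeff a b).continuousOn.mono hsub
  have cV := fun s (hs : s ∈ J) => continuousOn_slice hV hs
  have cV1 := fun a s (hs : s ∈ J) =>
    continuousOn_slice (F := fun s => partialDeriv a (V s)) (hV1 a) hs
  have cA := fun a b s (hs : s ∈ J) => continuousOn_slice (F := fun s => A s a b) (hA a b) hs
  have cA1 := fun a b => continuousOn_slice (F := fun t y => deriv (fun s => A s a b y) t)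
    ((h.continuousOn_deriv_coeff hJ hU a b).mono hsub) ht
  have cq := fun a => continuousOn_slice (F := fun s => q s a)
    ((h.continuousOn_drift a).mono hsub) ht
  have cγ := fun b => continuousOn_slice (F := fun s => defect ψ (A s) (q s) b)
    ((h.continuousOn_defect hJ hU hψ b).mono hsub) ht
  have cZ := continuousOn_slice (F := fun t => ellipticOp (A t) (q t) (V t))
    (h.continuousOn_ellipticOp.mono hsub) ht
  have cψ := hψ.continuous.continuousOn (s := tsupport ψ)
  have fψ : ContinuousOn (fun z : ℝ × Coord n => ψ z.2) (J ×ˢ tsupport ψ) :=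
    continuousOn_freeze cψ
  -- the contribution of the time dependence of the coefficients
  have d1 : ∀ a b, HasDerivAt (fun s => ∫ y in tsupport ψ, (A s a b y - A t a b y)
        * (ψ y * partialDeriv a (V s) y * partialDeriv b (V s) y))
      (∫ y in tsupport ψ, deriv (fun s => A s a b y) t
        * (ψ y * partialDeriv a (V t) y * partialDeriv b (V t) y)) t := by
    intro a b
    obtain ⟨ε, hε, hεJ⟩ := Metric.nhds_basis_closedBall.mem_iff.mp (hJ.mem_nhds ht)
    rw [Real.closedBall_eq_Icc] at hεJ
    have hεsub : Icc (t - ε) (t + ε) ×ˢ tsupport ψ ⊆ J ×ˢ U := prod_mono hεJ hsupp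
    obtain ⟨C, hC⟩ := (isCompact_Icc.prod hK).exists_bound_of_continuousOn
      ((h.continuousOn_deriv_coeff hJ hU a b).mono hεsub)
    have ha := hV1 a
    have hb := hV1 b
    have hr : ContinuousOn (fun z : ℝ × Coord n => ψ z.2 * partialDeriv a (V z.1) z.2
      * partialDeriv b (V z.1) z.2) (J ×ˢ tsupport ψ) := by fun_prop
    exact ConformalRicci.hasDerivAt_setIntegral_sub_mul hK (Q := fun s => A s a b)
      (Q' := fun t y => deriv (fun s => A s a b y) t)
      (r := fun s y => ψ y * partialDeriv a (V s) y * partialDeriv b (V s) y) hε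
      ((hA a b).mono (prod_mono hεJ le_rfl))
      (fun s hs y hy => h.hasDerivAt_coeff hJ hU (hεJ hs) (hsupp hy) a b)
      (fun s hs y hy => hC (s, y) ⟨hs, hy⟩) (hr.mono (prod_mono hεJ le_rfl))
  -- the contribution of the time dependence of the solution
  let r : ℝ → Coord n → ℝ := fun s y =>
    ψ y * ellipticOp (A t) (q t) (V s) y + ψ y * ellipticOp (A t) (q t) (V t) y
      + (∑ b, defect ψ (A t) (q t) b y * partialDeriv b (V s) y
        + ∑ b, defect ψ (A t) (q t) b y * partialDeriv b (V t) y)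
  have hr : ContinuousOn (fun z : ℝ × Coord n => r z.1 z.2) (J ×ˢ tsupport ψ) := by
    have fA : ∀ a b, ContinuousOn (fun z : ℝ × Coord n => A t a b z.2) (J ×ˢ tsupport ψ) :=
      fun a b => continuousOn_freeze (cA a b t ht)
    have fq : ∀ a, ContinuousOn (fun z : ℝ × Coord n => q t a z.2) (J ×ˢ tsupport ψ) :=
      fun a => continuousOn_freeze (cq a)
    have fγ : ∀ b, ContinuousOn (fun z : ℝ × Coord n => defect ψ (A t) (q t) b z.2)
      (J ×ˢ tsupport ψ) := fun b => continuousOn_freeze (cγ b)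
    have fZ : ContinuousOn (fun z : ℝ × Coord n => ellipticOp (A t) (q t) (V t) z.2)
      (J ×ˢ tsupport ψ) := continuousOn_freeze cZ
    have fV : ∀ a, ContinuousOn (fun z : ℝ × Coord n => partialDeriv a (V t) z.2)
      (J ×ˢ tsupport ψ) := fun a => continuousOn_freeze (cV1 a t ht)
    have fZs : ContinuousOn (fun z : ℝ × Coord n => ellipticOp (A t) (q t) (V z.1) z.2)
      (J ×ˢ tsupport ψ) := by
      exact (continuousOn_finsetSum _ fun a _ => continuousOn_finsetSum _ fun b _ =>
        (fA a b).mul (hV2 a b)).add (continuousOn_finsetSum _ fun a _ => (fq a).mul (hV1 a))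
    fun_prop
  have d2 := h.hasDerivAt_setIntegral_sub_mul hJ hK hsupp ht hr
  -- The energy at `s` is the energy at `t`, plus the change of the coefficients tested on `∂V_s`,
  -- plus the change of the frozen form. By `gradForm_self_sub` and integration by parts the last is
  -- `-∫ (V_s - V_t) r_s`, where `r` needs only to be continuous, so no mixed derivative `∂_t ∂_a V`
  -- occurs.
  have key := (((HasDerivAt.fun_sum fun a (_ : a ∈ Finset.univ) =>
    HasDerivAt.fun_sum fun b (_ : b ∈ Finset.univ) => d1 a b).sub d2).add_const
      (∫ y in tsupport ψ, ψ y * gradForm (A t) (V t) (V t) y))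
  have cZs : ∀ s ∈ J, ContinuousOn (ellipticOp (A t) (q t) (V s)) (tsupport ψ) := by
    intro s hs
    have e1 := fun a => cV1 a s hs
    have e2 := fun a b => continuousOn_slice (F := fun s => partialDeriv a (partialDeriv b (V s)))
      (hV2 a b) hs
    have e3 := fun a b => cA a b t ht
    unfold ellipticOp
    fun_prop
  have cVt := cV t ht
  have cV1t := fun a => cV1 a t ht
  have cAt := fun a b => cA a b t ht
  refine HasDerivAt.congr_deriv (key.congr_of_eventuallyEq ?_) ?_
  · filter_upwards [hJ.mem_nhds ht] with s hs
    have cVs := cV s hs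
    have cV1s := fun a => cV1 a s hs
    have cAs := fun a b => cA a b s hs
    have cZs' := cZs s hs
    have g1 : ∑ a, ∑ b, (∫ y in tsupport ψ, (A s a b y - A t a b y)
        * (ψ y * partialDeriv a (V s) y * partialDeriv b (V s) y))
        = ∫ y in tsupport ψ, (ψ y * gradForm (A s) (V s) (V s) y
          - ψ y * gradForm (A t) (V s) (V s) y) := by
      have hi : ∀ a b, IntegrableOn (fun y => (A s a b y - A t a b y)
        * (ψ y * partialDeriv a (V s) y * partialDeriv b (V s) y)) (tsupport ψ) :=
        fun a b => hint (by fun_prop)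
      simp only [← integral_finsetSum _ fun b _ => hi _ b]
      rw [← integral_finsetSum _ fun a _ => integrable_finsetSum _ fun b _ => hi a b]
      refine integral_congr_ae (Eventually.of_forall fun y => ?_)
      simp only [gradForm, Finset.mul_sum, ← Finset.sum_sub_distrib]
      exact Finset.sum_congr rfl fun a _ => Finset.sum_congr rfl fun b _ => by ring
    have hδ : ContDiffOn ℝ 1 (V s - V t) U :=
      ((h.contDiffOn s hs).sub (h.contDiffOn t ht)).of_le (by norm_num)
    have g2 : ∫ y in tsupport ψ, (V s y - V t y) * r s y
        = -(∫ y in tsupport ψ, ψ y * gradForm (A t) (V s - V t) (V s) y)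
          - ∫ y in tsupport ψ, ψ y * gradForm (A t) (V s - V t) (V t) y := by
      rw [h.setIntegral_gradForm hU hψ hc hsupp ht hδ (h.contDiffOn s hs),
        h.setIntegral_gradForm hU hψ hc hsupp ht hδ (h.contDiffOn t ht)]
      have i1 : IntegrableOn (fun y => ψ y * ((V s - V t) y * ellipticOp (A t) (q t) (V s) y))
        (tsupport ψ) := hint (by simp only [Pi.sub_apply]; fun_prop)
      have i2 : IntegrableOn (fun y => ψ y * ((V s - V t) y * ellipticOp (A t) (q t) (V t) y))
        (tsupport ψ) := hint (by simp only [Pi.sub_apply]; fun_prop)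
      have i3 : IntegrableOn (fun y => (V s - V t) y
        * ∑ b, defect ψ (A t) (q t) b y * partialDeriv b (V s) y)
        (tsupport ψ) := hint (by simp only [Pi.sub_apply]; fun_prop)
      have i4 : IntegrableOn (fun y => (V s - V t) y
        * ∑ b, defect ψ (A t) (q t) b y * partialDeriv b (V t) y)
        (tsupport ψ) := hint (by simp only [Pi.sub_apply]; fun_prop)
      have : ∀ x₁ x₂ x₃ x₄ : ℝ, -(-x₁ - x₃) - (-x₂ - x₄) = (x₁ + x₃) + (x₂ + x₄) :=
        fun _ _ _ _ => by ring
      rw [this, ← integral_add i1 i3, ← integral_add i2 i4]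
      rw [← integral_add (by exact i1.add i3) (by exact i2.add i4)]
      refine integral_congr_ae (Eventually.of_forall fun y => ?_)
      simp only [r, Pi.sub_apply]
      ring
    have cδ1 : ∀ a, ContinuousOn (partialDeriv a (V s - V t)) (tsupport ψ) := fun a =>
      (contDiffOn_partialDeriv (k := 0) hU hδ (by norm_num) a).continuousOn.mono hsupp
    have g3 : -(∫ y in tsupport ψ, (V s y - V t y) * r s y)
        = ∫ y in tsupport ψ, (ψ y * gradForm (A t) (V s) (V s) y
          - ψ y * gradForm (A t) (V t) (V t) y) := by
      rw [g2, neg_sub', neg_neg, sub_neg_eq_add, ← integral_add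
        (hint (by unfold gradForm; fun_prop)) (hint (by unfold gradForm; fun_prop))]
      refine setIntegral_congr_fun hK.measurableSet fun y hy => ?_
      simp only [← mul_add, ← mul_sub, h.gradForm_self_sub hU hs ht (hsupp hy)]
    rw [Pi.sub_apply, g1, sub_eq_add_neg, g3]
    have i1 : IntegrableOn (fun y => ψ y * gradForm (A s) (V s) (V s) y) (tsupport ψ) :=
      hint (by unfold gradForm; fun_prop)
    have i2 : IntegrableOn (fun y => ψ y * gradForm (A t) (V s) (V s) y) (tsupport ψ) :=
      hint (by unfold gradForm; fun_prop)
    have i3 : IntegrableOn (fun y => ψ y * gradForm (A t) (V t) (V t) y) (tsupport ψ) :=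
      hint (by unfold gradForm; fun_prop)
    rw [integral_sub i1 i2, integral_sub i2 i3]
    ring
  · have g1 : ∑ a, ∑ b, (∫ y in tsupport ψ, deriv (fun s => A s a b y) t
        * (ψ y * partialDeriv a (V t) y * partialDeriv b (V t) y))
        = ∫ y in tsupport ψ, ψ y * gradForm (fun a b y => deriv (fun s => A s a b y) t)
          (V t) (V t) y := by
      have hi : ∀ a b, IntegrableOn (fun y => deriv (fun s => A s a b y) t
        * (ψ y * partialDeriv a (V t) y * partialDeriv b (V t) y)) (tsupport ψ) :=
        fun a b => hint (by have := cA1 a b; fun_prop)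
      simp only [← integral_finsetSum _ fun b _ => hi _ b]
      rw [← integral_finsetSum _ fun a _ => integrable_finsetSum _ fun b _ => hi a b]
      refine integral_congr_ae (Eventually.of_forall fun y => ?_)
      simp only [gradForm, Finset.mul_sum]
      exact Finset.sum_congr rfl fun a _ => Finset.sum_congr rfl fun b _ => by ring
    -- The energy at `t` is also integrated by parts, so that the two terms with factor `c t` in
    -- `g2` recombine to `2 c t` times the energy.
    rw [g1, h.setIntegral_gradForm hU hψ hc hsupp ht ((h.contDiffOn t ht).of_le (by norm_num))
      (h.contDiffOn t ht)]
    have g2 : ∫ y in tsupport ψ, (ellipticOp (A t) (q t) (V t) y + c t * V t y) * r t y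
        = 2 * (∫ y in tsupport ψ, ψ y * ellipticOp (A t) (q t) (V t) y ^ 2)
          + 2 * (∫ y in tsupport ψ, ellipticOp (A t) (q t) (V t) y
            * ∑ b, defect ψ (A t) (q t) b y * partialDeriv b (V t) y)
          + 2 * c t * (∫ y in tsupport ψ, ψ y * (V t y * ellipticOp (A t) (q t) (V t) y))
          + 2 * c t * (∫ y in tsupport ψ, V t y
            * ∑ b, defect ψ (A t) (q t) b y * partialDeriv b (V t) y) := by
      simp only [← integral_const_mul]
      rw [← integral_add (hint (by fun_prop)) (hint (by fun_prop)),
        ← integral_add (hint (by fun_prop)) (hint (by fun_prop)),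
        ← integral_add (hint (by fun_prop)) (hint (by fun_prop))]
      refine integral_congr_ae (Eventually.of_forall fun y => ?_)
      simp only [r]
      ring
    rw [g2]
    ring

end IsLocalSolution

/-! ### Local estimates uniform on compact sets. -/

/-- The weighted inequality of arithmetic and geometric means, integrated. -/
theorem two_mul_abs_setIntegral_mul_le {E : Type*} [TopologicalSpace E] [T2Space E]
    [MeasurableSpace E] [BorelSpace E] {μ : Measure E} [IsFiniteMeasureOnCompacts μ]
    {K : Set E} (hK : IsCompact K) {w γ s : E → ℝ} {ε C : ℝ} (hε : 0 < ε)
    (hw : ContinuousOn w K) (hγ : ContinuousOn γ K) (hs : ContinuousOn s K)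
    (h : ∀ y ∈ K, γ y ^ 2 ≤ C * s y) :
    2 * |∫ y in K, w y * γ y ∂μ| ≤ ε * (∫ y in K, w y ^ 2 ∂μ) + ε⁻¹ * C * ∫ y in K, s y ∂μ := by
  have hint : ∀ {F : E → ℝ}, ContinuousOn F K → IntegrableOn F K μ :=
    fun hF => hF.integrableOn_compact hK
  refine (mul_le_mul_of_nonneg_left abs_integral_le_integral_abs zero_le_two).trans ?_
  rw [← integral_const_mul, ← integral_const_mul, ← integral_const_mul,
    ← integral_add (hint (by fun_prop)) (hint (by fun_prop))]
  refine setIntegral_mono_on (hint (by fun_prop)) (hint (by fun_prop)) hK.measurableSet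
    fun y hy => ?_
  have h1 : 0 ≤ ε⁻¹ * (ε * |w y| - |γ y|) ^ 2 := by positivity
  have h2 : ε⁻¹ * (ε * |w y| - |γ y|) ^ 2
      = ε * w y ^ 2 + ε⁻¹ * γ y ^ 2 - 2 * |w y * γ y| := by
    rw [abs_mul, ← sq_abs (w y), ← sq_abs (γ y)]
    field_simp
    ring
  have h3 : ε⁻¹ * γ y ^ 2 ≤ ε⁻¹ * (C * s y) :=
    mul_le_mul_of_nonneg_left (h y hy) (by positivity)
  linarith

namespace IsLocalSolution

variable {n : ℕ} {U : Set (Coord n)} {J : Set ℝ} {A : ℝ → Fin n → Fin n → Coord n → ℝ}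
  {q : ℝ → Fin n → Coord n → ℝ} {c : ℝ → ℝ} {V : ℝ → Coord n → ℝ} {ψ : Coord n → ℝ}

/-- Uniform ellipticity on compact sets. -/
theorem exists_gradSq_le (h : IsLocalSolution U J A q c V) {S : Set ℝ} (hS : IsCompact S)
    (hSJ : S ⊆ J) {K : Set (Coord n)} (hK : IsCompact K) (hKU : K ⊆ U) :
    ∃ C : ℝ, 0 < C ∧ ∀ t ∈ S, ∀ y ∈ K, ∀ u : Coord n → ℝ,
      gradSq u y ≤ C * gradForm (A t) u u y := by
  have hcont : ContinuousOn (fun z : (ℝ × Coord n) × Coord n =>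
      ∑ a, ∑ b, A z.1.1 a b z.1.2 * z.2 a * z.2 b) ((S ×ˢ K) ×ˢ Metric.sphere 0 1) := by
    have hA : ∀ a b, ContinuousOn (fun z : (ℝ × Coord n) × Coord n => A z.1.1 a b z.1.2)
        ((S ×ˢ K) ×ˢ Metric.sphere 0 1) := fun a b =>
      (h.contDiffOn_coeff a b).continuousOn.comp (f := fun z : (ℝ × Coord n) × Coord n => z.1)
        (by fun_prop) fun z hz => ⟨hSJ hz.1.1, hKU hz.1.2⟩
    have hξ : ∀ a, ContinuousOn (fun z : (ℝ × Coord n) × Coord n => z.2 a)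
        ((S ×ˢ K) ×ˢ Metric.sphere 0 1) := fun a => by fun_prop
    exact continuousOn_finsetSum _ fun a _ => continuousOn_finsetSum _ fun b _ =>
      ((hA a b).mul (hξ a)).mul (hξ b)
  -- On the compact set of times, points and unit vectors the quadratic form has a positive lower
  -- bound `m`. By homogeneity `m⁻¹` is the required constant.
  obtain ⟨m, hm0, hm⟩ := ((hS.prod hK).prod (isCompact_sphere 0 1)).exists_forall_le'
    hcont (a := 0) (by
      rintro ⟨⟨t, y⟩, ξ⟩ ⟨⟨ht, hy⟩, hξ⟩
      refine h.pos t (hSJ ht) y (hKU hy) ξ fun h0 => ?_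
      have h1 : ξ = 0 := by ext a; exact congrFun h0 a
      simp [h1] at hξ)
  refine ⟨m⁻¹, by positivity, fun t ht y hy u => ?_⟩
  have hG : gradForm (A t) u u y
      = ∑ a, ∑ b, A t a b y * partialDeriv a u y * partialDeriv b u y := rfl
  rcases (gradSq_nonneg u y).eq_or_lt with h0 | hpos
  · have h1 : ∀ a, partialDeriv a u y = 0 := by
      intro a
      have := (Finset.sum_eq_zero_iff_of_nonneg fun a _ => sq_nonneg _).mp h0.symm a
        (Finset.mem_univ a)
      simpa using this
    rw [← h0, hG]
    simp [h1]
  · set ρ := √(gradSq u y)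
    have hρ : 0 < ρ := Real.sqrt_pos.mpr hpos
    have hρ2 : ρ ^ 2 = gradSq u y := Real.sq_sqrt hpos.le
    let ξ : Coord n := WithLp.toLp 2 fun a => ρ⁻¹ * partialDeriv a u y
    have hξ : ξ ∈ Metric.sphere (0 : Coord n) 1 := by
      rw [mem_sphere_zero_iff_norm, EuclideanSpace.norm_eq, Real.sqrt_eq_one]
      simp only [ξ, Real.norm_eq_abs, sq_abs, mul_pow, ← Finset.mul_sum]
      rw [← gradSq, ← hρ2]
      field_simp
    have h2 := hm ((t, y), ξ) ⟨⟨ht, hy⟩, hξ⟩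
    have h3 : ∑ a, ∑ b, A t a b y * ξ a * ξ b = (ρ ^ 2)⁻¹ * gradForm (A t) u u y := by
      rw [hG, Finset.mul_sum]
      refine Finset.sum_congr rfl fun a _ => ?_
      rw [Finset.mul_sum]
      refine Finset.sum_congr rfl fun b _ => ?_
      simp only [ξ]
      field_simp
    rw [h3, hρ2] at h2
    rw [inv_mul_eq_div, le_div_iff₀ hm0]
    rw [inv_mul_eq_div, le_div_iff₀ hpos] at h2
    linarith

theorem exists_deriv_gradForm_le (h : IsLocalSolution U J A q c V) (hJ : IsOpen J)
    (hU : IsOpen U) {S : Set ℝ} (hS : IsCompact S) (hSJ : S ⊆ J) {K : Set (Coord n)}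
    (hK : IsCompact K) (hKU : K ⊆ U) :
    ∃ C : ℝ, 0 ≤ C ∧ ∀ t ∈ S, ∀ y ∈ K, ∀ u : Coord n → ℝ,
      gradForm (fun a b y => deriv (fun s => A s a b y) t) u u y ≤ C * gradSq u y := by
  choose m hm using fun a b => (hS.prod hK).exists_bound_of_continuousOn
    ((h.continuousOn_deriv_coeff hJ hU a b).mono (prod_mono hSJ hKU))
  refine ⟨∑ a, ∑ b, max (m a b) 0, Finset.sum_nonneg fun a _ => Finset.sum_nonneg fun b _ =>
    le_max_right _ _, fun t ht y hy u => ?_⟩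
  simp only [gradForm, Finset.sum_mul]
  refine Finset.sum_le_sum fun a _ => Finset.sum_le_sum fun b _ => ?_
  have h1 : ∀ a, partialDeriv a u y ^ 2 ≤ gradSq u y := fun a =>
    Finset.single_le_sum (f := fun a => partialDeriv a u y ^ 2) (fun a _ => sq_nonneg _)
      (Finset.mem_univ a)
  have h2 : |partialDeriv a u y * partialDeriv b u y| ≤ gradSq u y := by
    rw [abs_le]
    constructor <;> nlinarith [h1 a, h1 b, sq_nonneg (partialDeriv a u y + partialDeriv b u y),
      sq_nonneg (partialDeriv a u y - partialDeriv b u y)]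
  refine (le_abs_self _).trans ?_
  rw [mul_assoc, abs_mul]
  exact mul_le_mul ((hm a b (t, y) ⟨ht, hy⟩).trans (le_max_left _ _)) h2 (abs_nonneg _)
    (le_max_right _ _)

theorem exists_defect_sq_le (h : IsLocalSolution U J A q c V) (hJ : IsOpen J)
    (hU : IsOpen U) (hψ : ContDiff ℝ 1 ψ) {S : Set ℝ} (hS : IsCompact S) (hSJ : S ⊆ J)
    {K : Set (Coord n)} (hK : IsCompact K) (hKU : K ⊆ U) :
    ∃ C : ℝ, 0 ≤ C ∧ ∀ t ∈ S, ∀ y ∈ K, ∀ u : Coord n → ℝ,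
      (∑ b, defect ψ (A t) (q t) b y * partialDeriv b u y) ^ 2 ≤ C * gradSq u y := by
  have hc : ContinuousOn (fun z : ℝ × Coord n => ∑ b, defect ψ (A z.1) (q z.1) b z.2 ^ 2)
      (S ×ˢ K) := continuousOn_finsetSum _ fun b _ =>
    ((h.continuousOn_defect hJ hU hψ b).mono (prod_mono hSJ hKU)).pow 2
  obtain ⟨C, hC⟩ := (hS.prod hK).exists_bound_of_continuousOn hc
  refine ⟨max C 0, le_max_right _ _, fun t ht y hy u => ?_⟩
  refine (Finset.sum_mul_sq_le_sq_mul_sq _ _ _).trans ?_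
  exact mul_le_mul_of_nonneg_right
    (((le_abs_self _).trans (hC (t, y) ⟨ht, hy⟩)).trans (le_max_left _ _)) (gradSq_nonneg u y)

end IsLocalSolution

/-! ### Global mass, energy and defect, and backward uniqueness. -/

namespace BumpCover

variable {n : ℕ} {M : Type*} [TopologicalSpace M] [ChartedSpace (Coord n) M]
  {ι : Type*} (𝒞 : BumpCover n M ι)
  {A : ι → ℝ → Fin n → Fin n → Coord n → ℝ} {q : ι → ℝ → Fin n → Coord n → ℝ} {c : ℝ → ℝ}
  {v : ℝ → M → ℝ} {J : Set ℝ}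

variable [Fintype ι] in
/-- The Dirichlet energy of `v`, weighted with the bump functions. -/
noncomputable def energy (A : ι → ℝ → Fin n → Fin n → Coord n → ℝ) (v : ℝ → M → ℝ) (t : ℝ) : ℝ :=
  ∑ i, ∫ y in tsupport (𝒞.bump i), 𝒞.bump i y
    * gradForm (A i t) (v t ∘ (𝒞.chart i).symm) (v t ∘ (𝒞.chart i).symm) y

variable [Fintype ι] in
/-- The sum of the integrals of `u` over the chart domains, weighted with the bump functions. -/
noncomputable def mean (u : M → ℝ) : ℝ :=
  ∑ i, ∫ y in tsupport (𝒞.bump i), 𝒞.bump i y * u ((𝒞.chart i).symm y)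

variable [Fintype ι] in
/-- The first order form by which the operator differs from that of the Dirichlet energy. -/
noncomputable def defectForm (A : ι → ℝ → Fin n → Fin n → Coord n → ℝ)
    (q : ι → ℝ → Fin n → Coord n → ℝ) (v : ℝ → M → ℝ) (t : ℝ) (u : M → ℝ) : ℝ :=
  ∑ i, ∫ y in tsupport (𝒞.bump i), u ((𝒞.chart i).symm y)
    * ∑ b, defect (𝒞.bump i) (A i t) (q i t) b y * partialDeriv b (v t ∘ (𝒞.chart i).symm) y

theorem contDiff_one_bump (i : ι) : ContDiff ℝ 1 (𝒞.bump i) :=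
  (𝒞.contDiff_bump i).of_le (by simp)

theorem isCompact_tsupport (i : ι) : IsCompact (tsupport (𝒞.bump i)) := 𝒞.hasCompactSupport i

theorem integrableOn_tsupport {i : ι} {F : Coord n → ℝ}
    (hF : ContinuousOn F (tsupport (𝒞.bump i))) : IntegrableOn F (tsupport (𝒞.bump i)) :=
  hF.integrableOn_compact (𝒞.isCompact_tsupport i)

theorem continuousOn_bump (i : ι) (s : Set (Coord n)) : ContinuousOn (𝒞.bump i) s :=
  (𝒞.contDiff_bump i).continuous.continuousOn

theorem mean_sub_mul_sq [Fintype ι] {u w : M → ℝ}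
    (hu : ∀ i, ContinuousOn (u ∘ (𝒞.chart i).symm) (𝒞.chart i).target)
    (hw : ∀ i, ContinuousOn (w ∘ (𝒞.chart i).symm) (𝒞.chart i).target) (α : ℝ) :
    𝒞.mean (fun x => (w x - α * u x) ^ 2) = 𝒞.mean (fun x => w x ^ 2)
      - 2 * α * 𝒞.mean (fun x => u x * w x) + α ^ 2 * 𝒞.mean (fun x => u x ^ 2) := by
  simp only [mean]
  rw [Finset.mul_sum, Finset.mul_sum, ← Finset.sum_sub_distrib, ← Finset.sum_add_distrib]
  refine Finset.sum_congr rfl fun i _ => ?_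
  have h1 : ContinuousOn (fun y => u ((𝒞.chart i).symm y)) (tsupport (𝒞.bump i)) :=
    (hu i).mono (𝒞.tsupport_subset i)
  have h2 : ContinuousOn (fun y => w ((𝒞.chart i).symm y)) (tsupport (𝒞.bump i)) :=
    (hw i).mono (𝒞.tsupport_subset i)
  have h3 := 𝒞.continuousOn_bump i (tsupport (𝒞.bump i))
  have i1 : IntegrableOn (fun y => 𝒞.bump i y * w ((𝒞.chart i).symm y) ^ 2)
    (tsupport (𝒞.bump i)) := 𝒞.integrableOn_tsupport (h3.mul (h2.pow 2))
  have i2 : IntegrableOn (fun y => 2 * α * (𝒞.bump i y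
      * (u ((𝒞.chart i).symm y) * w ((𝒞.chart i).symm y)))) (tsupport (𝒞.bump i)) :=
    (𝒞.integrableOn_tsupport (h3.mul (h1.mul h2))).const_mul (2 * α)
  have i3 : IntegrableOn (fun y => α ^ 2 * (𝒞.bump i y * u ((𝒞.chart i).symm y) ^ 2))
    (tsupport (𝒞.bump i)) :=
    (𝒞.integrableOn_tsupport (h3.mul (h1.pow 2))).const_mul (α ^ 2)
  rw [← integral_const_mul, ← integral_const_mul, ← integral_sub i1 i2,
    ← integral_add (by exact i1.sub i2) i3]
  exact integral_congr_ae (Eventually.of_forall fun y => by ring)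

/-- The integrand is continuous and nonnegative. If `u y ≠ 0` at a core point, where the bump is
one, it would be nonzero on a neighbourhood of `y`, which has positive measure and lies in the
support. -/
theorem setIntegral_bump_sq_eq_zero {i : ι} {u : Coord n → ℝ}
    (hu : ContinuousOn u (𝒞.chart i).target)
    (h0 : ∫ y in tsupport (𝒞.bump i), 𝒞.bump i y * u y ^ 2 = 0) {y : Coord n}
    (hy : y ∈ 𝒞.core i) : u y = 0 := by
  by_contra hne
  have hy' := 𝒞.core_subset_target i hy
  have hc : ContinuousOn (fun y => 𝒞.bump i y * u y ^ 2) (𝒞.chart i).target :=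
    (𝒞.continuousOn_bump i _).mul (hu.pow 2)
  have hpos : 0 < ∫ y in tsupport (𝒞.bump i), 𝒞.bump i y * u y ^ 2 := by
    rw [setIntegral_pos_iff_support_of_nonneg_ae
      (Eventually.of_forall fun y => mul_nonneg (𝒞.bump_nonneg i y) (sq_nonneg _))
      (𝒞.integrableOn_tsupport (hc.mono (𝒞.tsupport_subset i)))]
    refine Measure.measure_pos_of_mem_nhds _ (x := y) ?_
    have hy0 : 𝒞.bump i y * u y ^ 2 ≠ 0 := by
      rw [𝒞.bump_eq_one i y hy, one_mul]
      exact pow_ne_zero 2 hne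
    filter_upwards [(hc.continuousAt ((𝒞.chart i).open_target.mem_nhds hy')).eventually_ne hy0]
      with x hx
    exact ⟨hx, subset_tsupport _ (left_ne_zero_of_mul hx)⟩
  exact hpos.ne' h0

theorem continuousOn_partialDeriv_solution
    (hloc : ∀ i, IsLocalSolution (𝒞.chart i).target J (A i) (q i) c
      fun t => v t ∘ (𝒞.chart i).symm) (i : ι) {t : ℝ} (ht : t ∈ J) (a : Fin n) :
    ContinuousOn (partialDeriv a (v t ∘ (𝒞.chart i).symm)) (tsupport (𝒞.bump i)) :=
  (continuousOn_slice (F := fun t => partialDeriv a (v t ∘ (𝒞.chart i).symm))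
    ((hloc i).continuousOn_deriv a) ht).mono (𝒞.tsupport_subset i)

theorem continuousOn_gradForm_solution
    (hloc : ∀ i, IsLocalSolution (𝒞.chart i).target J (A i) (q i) c
      fun t => v t ∘ (𝒞.chart i).symm) (i : ι) {t : ℝ} (ht : t ∈ J) :
    ContinuousOn (gradForm (A i t) (v t ∘ (𝒞.chart i).symm) (v t ∘ (𝒞.chart i).symm))
      (tsupport (𝒞.bump i)) := by
  have h1 := 𝒞.continuousOn_partialDeriv_solution hloc i ht
  have h2 := fun a b => ((hloc i).contDiffOn_coeff_slice ht a b).continuousOn.mono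
    (𝒞.tsupport_subset i)
  unfold gradForm
  fun_prop

theorem continuousOn_gradSq_solution
    (hloc : ∀ i, IsLocalSolution (𝒞.chart i).target J (A i) (q i) c
      fun t => v t ∘ (𝒞.chart i).symm) (i : ι) {t : ℝ} (ht : t ∈ J) :
    ContinuousOn (gradSq (v t ∘ (𝒞.chart i).symm)) (tsupport (𝒞.bump i)) := by
  have h1 := 𝒞.continuousOn_partialDeriv_solution hloc i ht
  unfold gradSq
  fun_prop

variable [Fintype ι]

theorem exists_gradSq_le_gradForm
    (hloc : ∀ i, IsLocalSolution (𝒞.chart i).target J (A i) (q i) c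
      fun t => v t ∘ (𝒞.chart i).symm) {a b : ℝ} (hab : Icc a b ⊆ J) :
    ∃ C : ℝ, 0 < C ∧ (∀ i, ∀ t ∈ Icc a b, ∀ y ∈ tsupport (𝒞.bump i),
      gradSq (v t ∘ (𝒞.chart i).symm) y
        ≤ C * gradForm (A i t) (v t ∘ (𝒞.chart i).symm) (v t ∘ (𝒞.chart i).symm) y) := by
  choose C hC0 hC using fun i => (hloc i).exists_gradSq_le isCompact_Icc hab
    (𝒞.isCompact_tsupport i) (𝒞.tsupport_subset i)
  refine ⟨∑ i, C i + 1, by have := Finset.sum_nonneg fun i (_ : i ∈ Finset.univ) => (hC0 i).le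
                           positivity, fun i t ht y hy => ?_⟩
  have h1 := hC i t ht y hy (v t ∘ (𝒞.chart i).symm)
  have h2 : C i ≤ ∑ i, C i + 1 := by
    have := Finset.single_le_sum (fun i _ => (hC0 i).le) (Finset.mem_univ i)
    linarith
  have h3 : 0 ≤ gradForm (A i t) (v t ∘ (𝒞.chart i).symm) (v t ∘ (𝒞.chart i).symm) y := by
    by_contra hneg
    have := mul_neg_of_pos_of_neg (hC0 i) (not_le.mp hneg)
    linarith [gradSq_nonneg (v t ∘ (𝒞.chart i).symm) y]
  exact h1.trans (mul_le_mul_of_nonneg_right h2 h3)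

theorem energy_nonneg
    (hloc : ∀ i, IsLocalSolution (𝒞.chart i).target J (A i) (q i) c
      fun t => v t ∘ (𝒞.chart i).symm) {a b : ℝ} (hab : Icc a b ⊆ J) {t : ℝ} (ht : t ∈ Icc a b) :
    0 ≤ 𝒞.energy A v t := by
  obtain ⟨C, hC0, hC⟩ := 𝒞.exists_gradSq_le_gradForm hloc hab
  refine Finset.sum_nonneg fun i _ => setIntegral_nonneg (isClosed_tsupport _).measurableSet
    fun y hy => mul_nonneg (𝒞.bump_nonneg i y) ?_
  by_contra hneg
  have := mul_neg_of_pos_of_neg hC0 (not_le.mp hneg)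
  linarith [hC i t ht y hy, gradSq_nonneg (v t ∘ (𝒞.chart i).symm) y]

theorem exists_sum_bump_gradSq_le
    (hloc : ∀ i, IsLocalSolution (𝒞.chart i).target J (A i) (q i) c
      fun t => v t ∘ (𝒞.chart i).symm) {a b : ℝ} (hab : Icc a b ⊆ J) :
    ∃ C : ℝ, 0 < C ∧ ∀ t ∈ Icc a b,
      ∑ i, ∫ y in tsupport (𝒞.bump i), 𝒞.bump i y * gradSq (v t ∘ (𝒞.chart i).symm) y
        ≤ C * 𝒞.energy A v t := by
  obtain ⟨C, hC0, hC⟩ := 𝒞.exists_gradSq_le_gradForm hloc hab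
  refine ⟨C, hC0, fun t ht => ?_⟩
  rw [energy, Finset.mul_sum]
  refine Finset.sum_le_sum fun i _ => ?_
  rw [← integral_const_mul]
  have h1 := 𝒞.continuousOn_gradForm_solution hloc i (hab ht)
  have h2 := 𝒞.continuousOn_gradSq_solution hloc i (hab ht)
  have h3 := 𝒞.continuousOn_bump i (tsupport (𝒞.bump i))
  refine setIntegral_mono_on (𝒞.integrableOn_tsupport (h3.mul h2))
    (𝒞.integrableOn_tsupport (continuousOn_const.mul (h3.mul h1)))
    (isClosed_tsupport _).measurableSet fun y hy => ?_
  calc _ ≤ 𝒞.bump i y * (C * gradForm (A i t) (v t ∘ (𝒞.chart i).symm)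
        (v t ∘ (𝒞.chart i).symm) y) :=
        mul_le_mul_of_nonneg_left (hC i t ht y hy) (𝒞.bump_nonneg i y)
    _ = _ := by ring

theorem exists_deriv_energy_le
    (hloc : ∀ i, IsLocalSolution (𝒞.chart i).target J (A i) (q i) c
      fun t => v t ∘ (𝒞.chart i).symm) (hJ : IsOpen J) {a b : ℝ} (hab : Icc a b ⊆ J) :
    ∃ C : ℝ, 0 ≤ C ∧ ∀ t ∈ Icc a b,
      ∑ i, ∫ y in tsupport (𝒞.bump i), 𝒞.bump i y
        * gradForm (fun a b y => deriv (fun s => A i s a b y) t) (v t ∘ (𝒞.chart i).symm)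
          (v t ∘ (𝒞.chart i).symm) y
        ≤ C * 𝒞.energy A v t := by
  choose C hC0 hC using fun i => (hloc i).exists_deriv_gradForm_le hJ (𝒞.chart i).open_target
    isCompact_Icc hab (𝒞.isCompact_tsupport i) (𝒞.tsupport_subset i)
  obtain ⟨C', hC'0, hC'⟩ := 𝒞.exists_sum_bump_gradSq_le hloc hab
  have hCs : 0 ≤ ∑ i, C i := Finset.sum_nonneg fun i _ => hC0 i
  refine ⟨(∑ i, C i) * C', by positivity, fun t ht => ?_⟩
  calc _ ≤ ∑ i, (∑ i, C i) * ∫ y in tsupport (𝒞.bump i),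
        𝒞.bump i y * gradSq (v t ∘ (𝒞.chart i).symm) y := by
        refine Finset.sum_le_sum fun i _ => ?_
        rw [← integral_const_mul]
        have h1 := 𝒞.continuousOn_partialDeriv_solution hloc i (hab ht)
        have h2 := 𝒞.continuousOn_gradSq_solution hloc i (hab ht)
        have h3 := 𝒞.continuousOn_bump i (tsupport (𝒞.bump i))
        have h4 := fun a b => (continuousOn_slice
          (F := fun t y => deriv (fun s => A i s a b y) t)
          ((hloc i).continuousOn_deriv_coeff hJ (𝒞.chart i).open_target a b) (hab ht)).mono
            (𝒞.tsupport_subset i)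
        refine setIntegral_mono_on (𝒞.integrableOn_tsupport (by unfold gradForm; fun_prop))
          (𝒞.integrableOn_tsupport (by fun_prop)) (isClosed_tsupport _).measurableSet
          fun y hy => ?_
        calc _ ≤ 𝒞.bump i y * (C i * gradSq (v t ∘ (𝒞.chart i).symm) y) :=
              mul_le_mul_of_nonneg_left (hC i t ht y hy _) (𝒞.bump_nonneg i y)
          _ ≤ 𝒞.bump i y * ((∑ i, C i) * gradSq (v t ∘ (𝒞.chart i).symm) y) := by
              refine mul_le_mul_of_nonneg_left (mul_le_mul_of_nonneg_right ?_
                (gradSq_nonneg _ _)) (𝒞.bump_nonneg i y)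
              exact Finset.single_le_sum (fun i _ => hC0 i) (Finset.mem_univ i)
          _ = _ := by ring
    _ ≤ (∑ i, C i) * (C' * 𝒞.energy A v t) := by
        rw [← Finset.mul_sum]
        exact mul_le_mul_of_nonneg_left (hC' t ht) hCs
    _ = _ := by ring

/-- The defect coefficients carry no factor `ψ_i`, so the weighted arithmetic-geometric inequality
first yields integrals without weights over the supports. The overlap comparisons bring the weights
back, and ellipticity bounds the gradient term by the energy. -/
theorem exists_defectForm_le [T2Space M]
    (hloc : ∀ i, IsLocalSolution (𝒞.chart i).target J (A i) (q i) c
      fun t => v t ∘ (𝒞.chart i).symm) (hJ : IsOpen J) {a b : ℝ} (hab : Icc a b ⊆ J)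
    (hv : ∀ t ∈ J, ContMDiff (𝓡 n) 𝓘(ℝ, ℝ) 2 (v t)) :
    ∃ C : ℝ, 0 ≤ C ∧ ∀ t ∈ Icc a b, ∀ u : M → ℝ,
      (∀ i, ContinuousOn (u ∘ (𝒞.chart i).symm) (𝒞.chart i).target) →
      2 * |𝒞.defectForm A q v t u| ≤ 2 * 𝒞.mean (fun x => u x ^ 2) + C * 𝒞.energy A v t := by
  choose C hC0 hC using fun i => (hloc i).exists_defect_sq_le hJ (𝒞.chart i).open_target
    (𝒞.contDiff_one_bump i) isCompact_Icc hab (𝒞.isCompact_tsupport i) (𝒞.tsupport_subset i)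
  obtain ⟨C₁, hC₁0, hC₁⟩ := 𝒞.exists_sum_bump_gradSq_le hloc hab
  obtain ⟨C₂, hC₂0, hC₂⟩ := 𝒞.exists_sum_setIntegral_sq_le
  obtain ⟨C₃, hC₃0, hC₃⟩ := 𝒞.exists_sum_setIntegral_gradSq_le
  have hCs : 0 ≤ ∑ i, C i := Finset.sum_nonneg fun i _ => hC0 i
  -- This `ε` turns the coefficient of `∫ u²` into exactly `2`, which the term `-2Q` in the
  -- derivative of the energy can absorb.
  set ε := 2 / C₂ with hε
  have hε0 : 0 < ε := by positivity
  refine ⟨ε⁻¹ * (∑ i, C i) * C₃ * C₁, by positivity, fun t ht u hu => ?_⟩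
  have hstep : 2 * |𝒞.defectForm A q v t u|
      ≤ ε * (∑ i, ∫ y in tsupport (𝒞.bump i), u ((𝒞.chart i).symm y) ^ 2)
        + ε⁻¹ * (∑ i, C i) * ∑ i, ∫ y in tsupport (𝒞.bump i),
          gradSq (v t ∘ (𝒞.chart i).symm) y := by
    refine (mul_le_mul_of_nonneg_left (Finset.abs_sum_le_sum_abs _ _) zero_le_two).trans ?_
    rw [Finset.mul_sum, Finset.mul_sum, Finset.mul_sum (a := ε⁻¹ * ∑ i, C i),
      ← Finset.sum_add_distrib]
    refine Finset.sum_le_sum fun i _ => ?_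
    have h1 := 𝒞.continuousOn_partialDeriv_solution hloc i (hab ht)
    have h2 := 𝒞.continuousOn_gradSq_solution hloc i (hab ht)
    have h3 : ContinuousOn (fun y => u ((𝒞.chart i).symm y)) (tsupport (𝒞.bump i)) :=
      (hu i).mono (𝒞.tsupport_subset i)
    have h4 := fun b => (continuousOn_slice (F := fun t => defect (𝒞.bump i) (A i t) (q i t) b)
      ((hloc i).continuousOn_defect hJ (𝒞.chart i).open_target (𝒞.contDiff_one_bump i) b)
      (hab ht)).mono (𝒞.tsupport_subset i)
    have h5 : ContinuousOn (fun y => ∑ b, defect (𝒞.bump i) (A i t) (q i t) b y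
        * partialDeriv b (v t ∘ (𝒞.chart i).symm) y) (tsupport (𝒞.bump i)) := by fun_prop
    refine two_mul_abs_setIntegral_mul_le (𝒞.isCompact_tsupport i) hε0 h3 h5 h2 fun y hy => ?_
    exact (hC i t ht y hy (v t ∘ (𝒞.chart i).symm)).trans (mul_le_mul_of_nonneg_right
      (Finset.single_le_sum (fun i _ => hC0 i) (Finset.mem_univ i)) (gradSq_nonneg _ _))
  refine hstep.trans (add_le_add ?_ ?_)
  · calc _ ≤ ε * (C₂ * 𝒞.mean fun x => u x ^ 2) :=
          mul_le_mul_of_nonneg_left (hC₂ u hu) hε0.le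
      _ = _ := by rw [hε]; field_simp
  · calc _ ≤ ε⁻¹ * (∑ i, C i) * (C₃ * (C₁ * 𝒞.energy A v t)) := by
          refine mul_le_mul_of_nonneg_left ((hC₃ _ (hv t (hab ht))).trans ?_) (by positivity)
          exact mul_le_mul_of_nonneg_left (hC₁ t ht) hC₃0
      _ = _ := by ring

theorem defectForm_sub_mul
    (hloc : ∀ i, IsLocalSolution (𝒞.chart i).target J (A i) (q i) c
      fun t => v t ∘ (𝒞.chart i).symm) (hJ : IsOpen J) {t : ℝ} (ht : t ∈ J) {u w : M → ℝ}
    (hu : ∀ i, ContinuousOn (u ∘ (𝒞.chart i).symm) (𝒞.chart i).target)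
    (hw : ∀ i, ContinuousOn (w ∘ (𝒞.chart i).symm) (𝒞.chart i).target) (α : ℝ) :
    𝒞.defectForm A q v t (fun x => w x - α * u x)
      = 𝒞.defectForm A q v t w - α * 𝒞.defectForm A q v t u := by
  simp only [defectForm]
  rw [Finset.mul_sum, ← Finset.sum_sub_distrib]
  refine Finset.sum_congr rfl fun i _ => ?_
  have h1 : ContinuousOn (fun y => u ((𝒞.chart i).symm y)) (tsupport (𝒞.bump i)) :=
    (hu i).mono (𝒞.tsupport_subset i)
  have h2 : ContinuousOn (fun y => w ((𝒞.chart i).symm y)) (tsupport (𝒞.bump i)) :=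
    (hw i).mono (𝒞.tsupport_subset i)
  have h3 : ContinuousOn (fun y => ∑ b, defect (𝒞.bump i) (A i t) (q i t) b y
      * partialDeriv b (v t ∘ (𝒞.chart i).symm) y) (tsupport (𝒞.bump i)) := by
    have h4 := 𝒞.continuousOn_partialDeriv_solution hloc i ht
    have h5 := fun b => (continuousOn_slice (F := fun t => defect (𝒞.bump i) (A i t) (q i t) b)
      ((hloc i).continuousOn_defect hJ (𝒞.chart i).open_target (𝒞.contDiff_one_bump i) b)
      ht).mono (𝒞.tsupport_subset i)
    fun_prop
  rw [← integral_const_mul, ← integral_sub (by exact 𝒞.integrableOn_tsupport (h2.mul h3))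
      (by exact (𝒞.integrableOn_tsupport (h1.mul h3)).const_mul _)]
  exact integral_congr_ae (Eventually.of_forall fun y => by ring)

/-- **Backward uniqueness** for linear parabolic equations of second order with time dependent
coefficients on a compact manifold without boundary. -/
theorem eq_zero_of_isLocalSolution [T2Space M]
    (hloc : ∀ i, IsLocalSolution (𝒞.chart i).target J (A i) (q i) c
      fun t => v t ∘ (𝒞.chart i).symm) (hJ : IsOpen J) {a b : ℝ} (hab : Icc a b ⊆ J)
    (hv : ∀ t ∈ J, ContMDiff (𝓡 n) 𝓘(ℝ, ℝ) 2 (v t)) (hb : ∀ x, v b x = 0) :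
    ∀ t ∈ Icc a b, ∀ x, v t x = 0 := by
  intro t₁ ht₁ x₁
  obtain ⟨i₁, hi₁, hx₁⟩ := 𝒞.exists_mem_core x₁
  obtain ⟨C₀, hC₀⟩ := (hloc i₁).bounded
  obtain ⟨C₁, hC₁0, hC₁⟩ := 𝒞.exists_deriv_energy_le hloc hJ hab
  obtain ⟨C₂, hC₂0, hC₂⟩ := 𝒞.exists_defectForm_le hloc hJ hab hv
  have hC₀0 : 0 ≤ C₀ := (abs_nonneg _).trans (hC₀ t₁ (hab ht₁))
  -- Defined as `∂_t v - c v`, the function `z` lives on `M`; the equation identifies it with the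
  -- local operator in every chart of the cover at once.
  obtain ⟨z, hz⟩ : ∃ z : ℝ → M → ℝ, ∀ i, ∀ t ∈ J, ∀ y ∈ (𝒞.chart i).target,
      z t ((𝒞.chart i).symm y)
        = ellipticOp (A i t) (q i t) (v t ∘ (𝒞.chart i).symm) y := by
    refine ⟨fun t x => deriv (fun s => v s x) t - c t * v t x, fun i t ht y hy => ?_⟩
    have := ((hloc i).hasDerivAt t ht y hy).deriv
    simp only [Function.comp_apply] at this
    simp only [this]
    ring
  have cv : ∀ i, ∀ t ∈ J, ContinuousOn (v t ∘ (𝒞.chart i).symm) (𝒞.chart i).target :=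
    fun i t ht => ((hloc i).contDiffOn t ht).continuousOn
  have cz : ∀ i, ∀ t ∈ J, ContinuousOn (z t ∘ (𝒞.chart i).symm) (𝒞.chart i).target :=
    fun i t ht => (continuousOn_slice
      (F := fun t => ellipticOp (A i t) (q i t) (v t ∘ (𝒞.chart i).symm))
      (hloc i).continuousOn_ellipticOp ht).congr fun y hy => hz i t ht y hy
  set I : ℝ → ℝ := fun t => 𝒞.mean fun x => v t x ^ 2 with hI
  set P : ℝ → ℝ := fun t => 𝒞.mean fun x => v t x * z t x with hP
  set Q : ℝ → ℝ := fun t => 𝒞.mean fun x => z t x ^ 2 with hQ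
  set R : ℝ → ℝ := fun t => ∑ i, ∫ y in tsupport (𝒞.bump i), 𝒞.bump i y
    * gradForm (fun a b y => deriv (fun s => A i s a b y) t) (v t ∘ (𝒞.chart i).symm)
      (v t ∘ (𝒞.chart i).symm) y with hR
  have dI : ∀ t ∈ Icc a b, HasDerivAt I (2 * P t + 2 * c t * I t) t := by
    intro t ht
    have key := HasDerivAt.fun_sum fun i (_ : i ∈ Finset.univ) =>
      (hloc i).hasDerivAt_mass hJ (𝒞.contDiff_one_bump i) (𝒞.hasCompactSupport i)
        (𝒞.tsupport_subset i) (hab ht)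
    refine key.congr_deriv ?_
    rw [Finset.sum_add_distrib, ← Finset.mul_sum, ← Finset.mul_sum]
    congr 2
    refine Finset.sum_congr rfl fun i _ => setIntegral_congr_fun
      (isClosed_tsupport _).measurableSet fun y hy => ?_
    simp only [hz i t (hab ht) y (𝒞.tsupport_subset i hy), Function.comp_apply]
  have dD : ∀ t ∈ Icc a b, HasDerivAt (𝒞.energy A v) (R t - 2 * Q t
      - 2 * 𝒞.defectForm A q v t (z t) + 2 * c t * 𝒞.energy A v t) t := by
    intro t ht
    have key := HasDerivAt.fun_sum fun i (_ : i ∈ Finset.univ) =>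
      (hloc i).hasDerivAt_energy hJ (𝒞.chart i).open_target (𝒞.contDiff_one_bump i)
        (𝒞.hasCompactSupport i) (𝒞.tsupport_subset i) (hab ht)
    refine key.congr_deriv ?_
    rw [Finset.sum_add_distrib, Finset.sum_sub_distrib, Finset.sum_sub_distrib,
      ← Finset.mul_sum, ← Finset.mul_sum, ← Finset.mul_sum]
    have e1 : ∑ i, ∫ y in tsupport (𝒞.bump i), 𝒞.bump i y
        * ellipticOp (A i t) (q i t) (v t ∘ (𝒞.chart i).symm) y ^ 2 = Q t :=
      Finset.sum_congr rfl fun i _ => setIntegral_congr_fun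
        (isClosed_tsupport _).measurableSet fun y hy => by
          simp only [hz i t (hab ht) y (𝒞.tsupport_subset i hy)]
    have e2 : ∑ i, ∫ y in tsupport (𝒞.bump i),
        ellipticOp (A i t) (q i t) (v t ∘ (𝒞.chart i).symm) y
          * ∑ b, defect (𝒞.bump i) (A i t) (q i t) b y
            * partialDeriv b (v t ∘ (𝒞.chart i).symm) y = 𝒞.defectForm A q v t (z t) :=
      Finset.sum_congr rfl fun i _ => setIntegral_congr_fun
        (isClosed_tsupport _).measurableSet fun y hy => by
          simp only [hz i t (hab ht) y (𝒞.tsupport_subset i hy)]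
    rw [e1, e2]
    rfl
  have hDir : ∀ t ∈ Icc a b, 𝒞.energy A v t = -P t - 𝒞.defectForm A q v t (v t) := by
    intro t ht
    rw [hP]
    simp only [energy, mean, defectForm]
    rw [← Finset.sum_neg_distrib, ← Finset.sum_sub_distrib]
    refine Finset.sum_congr rfl fun i _ => ?_
    have h1 := (hloc i).contDiffOn t (hab ht)
    rw [(hloc i).setIntegral_gradForm (𝒞.chart i).open_target (𝒞.contDiff_one_bump i)
      (𝒞.hasCompactSupport i) (𝒞.tsupport_subset i) (hab ht) (h1.of_le (by norm_num)) h1]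
    congr 2
    refine setIntegral_congr_fun (isClosed_tsupport _).measurableSet fun y hy => ?_
    simp only [hz i t (hab ht) y (𝒞.tsupport_subset i hy), Function.comp_apply]
  have hmean : ∀ t ∈ Icc a b, ∀ α : ℝ, 𝒞.mean (fun x => (z t x - α * v t x) ^ 2)
      = Q t - 2 * α * P t + α ^ 2 * I t := fun t ht α =>
    𝒞.mean_sub_mul_sq (fun i => cv i t (hab ht)) (fun i => cz i t (hab ht)) α
  have hdef : ∀ t ∈ Icc a b, ∀ α : ℝ, 𝒞.defectForm A q v t (fun x => z t x - α * v t x)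
      = 𝒞.defectForm A q v t (z t) - α * 𝒞.defectForm A q v t (v t) := fun t ht α =>
    𝒞.defectForm_sub_mul hloc hJ (hab ht) (fun i => cv i t (hab ht)) (fun i => cz i t (hab ht)) α
  have hI0 : ∀ t, 0 ≤ I t := fun t => Finset.sum_nonneg fun i _ =>
    integral_nonneg fun y => mul_nonneg (𝒞.bump_nonneg i y) (sq_nonneg _)
  have hD0 : ∀ t ∈ Icc a b, 0 ≤ 𝒞.energy A v t := fun t ht => 𝒞.energy_nonneg hloc hab ht
  -- Since `2P = -2D - 2B(v) ≥ -(2 + C₂) D - 2I` and `2cI ≥ -2C₀ I`, the coefficient `2 + C₂ + 2C₀`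
  -- would suffice here. The summand `C₁` is there for `hfreq`, so that one constant serves both
  -- estimates.
  have hlow : ∀ t ∈ Icc a b,
      -(2 + C₁ + C₂ + 2 * C₀) * (𝒞.energy A v t + I t) ≤ 2 * P t + 2 * c t * I t := by
    intro t ht
    have h1 := hC₂ t ht (v t) fun i => cv i t (hab ht)
    have h2 := hDir t ht
    have h3 := abs_le.mp (hC₀ t (hab ht))
    have h4 : -C₀ * I t ≤ c t * I t := mul_le_mul_of_nonneg_right h3.1 (hI0 t)
    have h5 := le_abs_self (𝒞.defectForm A q v t (v t))
    have h6 := mul_nonneg hC₁0 (hI0 t)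
    have h7 := mul_nonneg hC₁0 (hD0 t ht)
    have h8 := mul_nonneg hC₂0 (hI0 t)
    have h9 := mul_nonneg hC₀0 (hD0 t ht)
    have h10 : 2 * 𝒞.defectForm A q v t (v t) ≤ 2 * I t + C₂ * 𝒞.energy A v t := by linarith
    linarith
  have hfreq : ∀ t ∈ Icc a b, 0 < I t → (R t - 2 * Q t
      - 2 * 𝒞.defectForm A q v t (z t) + 2 * c t * 𝒞.energy A v t) * I t
      - 𝒞.energy A v t * (2 * P t + 2 * c t * I t)
      ≤ (2 + C₁ + C₂ + 2 * C₀) * 𝒞.energy A v t * I t := by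
    intro t ht hpos
    -- This `α` minimises `∫ (z - αv)²`, with minimum `Q - P²/I`. Substituting `D = -P - B(v)` in
    -- the product `D P` turns the left side into `R I - 2(QI - P²) - 2 I B(z - αv)`. The bound `h1`
    -- on the last term cancels the middle one and leaves `(C₁ + C₂) D I`.
    set α := P t / I t with hα
    have hαI : α * I t = P t := div_mul_cancel₀ _ hpos.ne'
    have hcu : ∀ i, ContinuousOn ((fun x => z t x - α * v t x) ∘ (𝒞.chart i).symm)
        (𝒞.chart i).target := fun i =>
      (cz i t (hab ht)).sub (continuousOn_const.mul (cv i t (hab ht)))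
    have h1 := hC₂ t ht (fun x => z t x - α * v t x) hcu
    rw [hmean t ht, hdef t ht] at h1
    have h2 := hC₁ t ht
    have h3 := neg_abs_le (𝒞.defectForm A q v t (z t) - α * 𝒞.defectForm A q v t (v t))
    have h4 := hDir t ht
    have h5 := mul_nonneg (hD0 t ht) hpos.le
    set E₁ := 𝒞.defectForm A q v t (v t)
    set E₂ := 𝒞.defectForm A q v t (z t)
    set D := 𝒞.energy A v t
    have h6 : (-2 * (E₂ - α * E₁)) * I t
        ≤ (2 * (Q t - 2 * α * P t + α ^ 2 * I t) + C₂ * D) * I t :=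
      mul_le_mul_of_nonneg_right (by linarith) hpos.le
    have h7 : R t * I t ≤ C₁ * D * I t := mul_le_mul_of_nonneg_right h2 hpos.le
    have h8 : α * E₁ * I t = P t * E₁ := by rw [← hαI]; ring
    have h9 : α * P t * I t = P t ^ 2 := by rw [mul_right_comm, hαI]; ring
    have h10 : α ^ 2 * I t * I t = P t ^ 2 := by rw [← hαI]; ring
    have h11 : D * P t = -P t ^ 2 - P t * E₁ := by rw [h4]; ring
    have h12 := mul_nonneg hC₀0 h5
    nlinarith
  have hIb : I b = 0 := by
    simp [hI, mean, hb]
  have hmain := eq_zero_of_frequency_bound (by positivity) dI dD (fun t _ => hI0 t) hD0 hlow hfreq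
    hIb t₁ ht₁
  have hterm : ∫ y in tsupport (𝒞.bump i₁), 𝒞.bump i₁ y * v t₁ ((𝒞.chart i₁).symm y) ^ 2 = 0 :=
    (Finset.sum_eq_zero_iff_of_nonneg fun i _ => integral_nonneg fun y =>
      mul_nonneg (𝒞.bump_nonneg i y) (sq_nonneg _)).mp hmain i₁ (Finset.mem_univ _)
  have := 𝒞.setIntegral_bump_sq_eq_zero (cv i₁ t₁ (hab ht₁)) hterm hx₁
  rwa [Function.comp_apply, (𝒞.chart i₁).left_inv hi₁] at this

end BumpCover

/-! ### The metric in charts and the Laplacian as an elliptic operator. -/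

section Metric

variable {n : ℕ} {M : Type*} [TopologicalSpace M] [ChartedSpace (Coord n) M]

theorem injective_mfderiv_symm {e : OpenPartialHomeomorph M (Coord n)}
    (he : e ∈ smoothCharts n M) {y : Coord n} (hy : y ∈ e.target) (ξ : Coord n)
    (h0 : mfderiv (𝓡 n) (𝓡 n) e.symm y ξ = 0) : ξ = 0 := by
  have hd : e.MDifferentiable (𝓡 n) (𝓡 n) :=
    ⟨(contMDiffOn_of_mem_maximalAtlas he).mdifferentiableOn (by simp),
      (contMDiffOn_symm_of_mem_maximalAtlas he).mdifferentiableOn (by simp)⟩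
  have h1 := congrArg (fun L => L ξ) (hd.comp_symm_deriv hy)
  have h2 : (mfderiv (𝓡 n) (𝓡 n) e (e.symm y)) (mfderiv (𝓡 n) (𝓡 n) e.symm y ξ) = ξ := h1
  rw [h0, map_zero] at h2
  exact h2.symm

variable [IsManifold (𝓡 n) ∞ M]

theorem metricMatrix_symm (g : Metric n M) (e : OpenPartialHomeomorph M (Coord n)) (y : Coord n)
    (i j : Fin n) : metricMatrix g e y i j = metricMatrix g e y j i :=
  g.symm _ _ _

/-- This is the Gram matrix of the coordinate frame: its quadratic form at `ξ` is `g(X, X)` with `X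
= ξ^i ∂_i`, and `X` vanishes only for `ξ = 0` because the derivative of the inverse chart is
injective. -/
theorem posDef_metricMatrix (g : Metric n M) {e : OpenPartialHomeomorph M (Coord n)}
    (he : e ∈ smoothCharts n M) {y : Coord n} (hy : y ∈ e.target) :
    (metricMatrix g e y).PosDef := by
  refine Matrix.PosDef.of_dotProduct_mulVec_pos (Matrix.IsHermitian.ext fun i j => by
    simpa using metricMatrix_symm g e y j i) fun ξ hξ => ?_
  set X : TangentSpace (𝓡 n) (e.symm y) := mfderiv (𝓡 n) (𝓡 n) e.symm y (WithLp.toLp 2 ξ) with hX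
  have hX0 : X ≠ 0 := by
    intro h0
    apply hξ
    have := injective_mfderiv_symm he hy _ h0
    ext i
    exact congrArg (fun v : Coord n => v i) this
  have hsum : X = ∑ i, ξ i • coordVector e y i := by
    have h1 : (WithLp.toLp 2 ξ : Coord n) = ∑ i, ξ i • EuclideanSpace.single i (1 : ℝ) := by
      conv_lhs => rw [← (EuclideanSpace.basisFun (Fin n) ℝ).sum_repr (WithLp.toLp 2 ξ)]
      simp
    rw [hX, h1]
    exact (map_sum _ _ _).trans (Finset.sum_congr rfl fun i _ => map_smul _ _ _)
  have hpos := g.pos (e.symm y) X hX0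
  have h2 : g.inner (e.symm y) X X = ∑ i, ∑ j, ξ i * (metricMatrix g e y i j * ξ j) := by
    rw [hsum, map_sum]
    simp only [map_smul, sum_apply, map_sum, smul_apply,
      smul_eq_mul, metricMatrix, Matrix.of_apply, Finset.mul_sum]
    refine Finset.sum_congr rfl fun i _ => Finset.sum_congr rfl fun j _ => ?_
    rw [g.symm (e.symm y) (coordVector e y j) (coordVector e y i)]
    ring
  rw [h2] at hpos
  simpa [dotProduct, Matrix.mulVec, Finset.mul_sum] using hpos

end Metric

theorem contDiffOn_det {E : Type*} [NormedAddCommGroup E] [NormedSpace ℝ E] {n : ℕ} {k : ℕ∞ω}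
    {s : Set E} {G : E → Matrix (Fin n) (Fin n) ℝ}
    (hG : ∀ i j, ContDiffOn ℝ k (fun z => G z i j) s) :
    ContDiffOn ℝ k (fun z => (G z).det) s := by
  simp only [Matrix.det_apply]
  exact ContDiffOn.sum fun σ _ => (contDiffOn_prod fun i _ => hG _ _).const_smul _

/-- By Cramer's rule the entries of the inverse are quotients of polynomials in the entries of `G`.
The domain `E` is arbitrary, so that time can be included among the variables. -/
theorem contDiffOn_matrix_inv {E : Type*} [NormedAddCommGroup E] [NormedSpace ℝ E] {n : ℕ}
    {k : ℕ∞ω} {s : Set E} {G : E → Matrix (Fin n) (Fin n) ℝ}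
    (hG : ∀ i j, ContDiffOn ℝ k (fun z => G z i j) s) (h0 : ∀ z ∈ s, (G z).det ≠ 0)
    (i j : Fin n) : ContDiffOn ℝ k (fun z => (G z)⁻¹ i j) s := by
  have h1 : ∀ z, (G z)⁻¹ i j = (G z).det⁻¹ * ((G z).updateRow j (Pi.single i 1)).det := by
    intro z
    rw [Matrix.inv_def, Matrix.smul_apply, Matrix.adjugate_apply, Ring.inverse_eq_inv', smul_eq_mul]
  simp only [h1]
  refine ((contDiffOn_det hG).inv h0).mul (contDiffOn_det fun a b => ?_)
  by_cases ha : a = j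
  · subst ha
    simp only [Matrix.updateRow_self]
    exact contDiffOn_const
  · simp only [Matrix.updateRow_ne ha]
    exact hG a b

/-- The coefficients `g^{ij}` of the second order part of the Laplace-Beltrami operator. -/
noncomputable def laplacianCoeff {n : ℕ} (G : Coord n → Matrix (Fin n) (Fin n) ℝ) (i j : Fin n)
    (y : Coord n) : ℝ := (G y)⁻¹ i j

/-- The coefficients `-g^{ij} Γ^k_ij` of the first order part of the Laplace-Beltrami operator. -/
noncomputable def laplacianDrift {n : ℕ} (G : Coord n → Matrix (Fin n) (Fin n) ℝ) (k : Fin n)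
    (y : Coord n) : ℝ := -∑ i, ∑ j, (G y)⁻¹ i j * christoffel G k i j y

theorem laplacian_eq_ellipticOp {n : ℕ} (G : Coord n → Matrix (Fin n) (Fin n) ℝ)
    (u : Coord n → ℝ) (y : Coord n) :
    laplacian G u y = ellipticOp (laplacianCoeff G) (laplacianDrift G) u y := by
  have h : ∑ k, laplacianDrift G k y * partialDeriv k u y
      = -∑ i, ∑ j, (G y)⁻¹ i j * ∑ k, christoffel G k i j y * partialDeriv k u y := by
    simp only [laplacianDrift, neg_mul, Finset.sum_neg_distrib, Finset.sum_mul, Finset.mul_sum]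
    rw [Finset.sum_comm]
    congr 1
    refine Finset.sum_congr rfl fun i _ => ?_
    rw [Finset.sum_comm]
    exact Finset.sum_congr rfl fun j _ => Finset.sum_congr rfl fun k _ => by ring
  rw [ellipticOp, h]
  simp only [laplacian, hessian, laplacianCoeff, mul_sub, Finset.sum_sub_distrib]
  ring

theorem exists_abs_maxPressure_le {n : ℕ} {M : Type*} [TopologicalSpace M] [CompactSpace M]
    [ChartedSpace (Coord n) M] {T : ℝ} {p : ℝ → M → ℝ} (hp : SmoothUpTo n T p) {a b : ℝ}
    (ha : 0 ≤ a) (hb : b < T) : ∃ C, ∀ t ∈ Icc a b, |maxPressure p t| ≤ C := by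
  have hc : ContinuousOn (fun q : ℝ × M => p q.1 q.2) (Icc a b ×ˢ univ) :=
    (ContMDiffOn.continuousOn hp).mono
      (prod_mono (fun t ht => ⟨ha.trans ht.1, ht.2.trans_lt hb⟩) le_rfl)
  obtain ⟨C, hC⟩ := (isCompact_Icc.prod isCompact_univ).exists_bound_of_continuousOn hc
  refine ⟨max C 0, fun t ht => ?_⟩
  have h1 : ∀ x, |p t x| ≤ max C 0 := fun x => (hC (t, x) ⟨ht, mem_univ x⟩).trans (le_max_left _ _)
  rcases isEmpty_or_nonempty M with hM | ⟨⟨x⟩⟩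
  -- Over an empty `M` the real supremum takes the default value `0`.
  · simp [maxPressure]
  · have hbdd : BddAbove (range (p t)) := ⟨max C 0, by
      rintro _ ⟨x, rfl⟩; exact (abs_le.mp (h1 x)).2⟩
    have : Nonempty M := ⟨x⟩
    exact abs_le.mpr ⟨(abs_le.mp (h1 x)).1.trans (le_ciSup hbdd x),
      ciSup_le fun x => (abs_le.mp (h1 x)).2⟩

/-! ### Heat solutions along the flow as local parabolic solutions. -/

section Flow

variable {m : ℕ} {M : Type*} [TopologicalSpace M] [ChartedSpace (Coord (m + 1)) M]
  [IsManifold (𝓡 (m + 1)) ∞ M] {T : ℝ} {g : ℝ → Metric (m + 1) M} {p v : ℝ → M → ℝ}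

theorem contDiffOn_inv_metricMatrix (hflow : IsConformalRicciFlow m T g p)
    {e : OpenPartialHomeomorph M (Coord (m + 1))} (he : e ∈ smoothCharts (m + 1) M)
    (i j : Fin (m + 1)) :
    ContDiffOn ℝ ∞ (fun z : ℝ × Coord (m + 1) => (metricMatrix (g z.1) e z.2)⁻¹ i j)
      (Ico 0 T ×ˢ e.target) :=
  contDiffOn_matrix_inv (hflow.smooth_metric e he)
    (fun z hz => (posDef_metricMatrix (g z.1) he hz.2).det_pos.ne') i j

theorem continuousOn_christoffel (hflow : IsConformalRicciFlow m T g p)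
    {e : OpenPartialHomeomorph M (Coord (m + 1))} (he : e ∈ smoothCharts (m + 1) M)
    (k i j : Fin (m + 1)) :
    ContinuousOn (fun z : ℝ × Coord (m + 1) => christoffel (metricMatrix (g z.1) e) k i j z.2)
      (Ioo 0 T ×ˢ e.target) := by
  have hsub : Ioo 0 T ×ˢ e.target ⊆ Ico 0 T ×ˢ e.target :=
    prod_mono Ioo_subset_Ico_self le_rfl
  have h1 := fun i j => (contDiffOn_inv_metricMatrix hflow he i j).continuousOn.mono hsub
  have h2 : ∀ a i j, ContinuousOn (fun z : ℝ × Coord (m + 1) =>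
      partialDeriv a (fun y => metricMatrix (g z.1) e y i j) z.2) (Ioo 0 T ×ˢ e.target) :=
    fun a i j => continuousOn_partialDeriv_slice (isOpen_Ioo.prod e.open_target)
      (((hflow.smooth_metric e he i j).mono hsub).of_le (by simp)) a
  exact continuousOn_const.mul (continuousOn_finsetSum _ fun l _ =>
    (h1 k l).mul (((h2 i j l).add (h2 j i l)).sub (h2 l i j)))

/-- On an open time interval inside `(0, T)` the one-sided derivatives become two-sided. Its upper
end stays below `T`, so the pressure is bounded there by compactness. -/
theorem isLocalSolution_of_isHeatSolution [CompactSpace M] (hflow : IsConformalRicciFlow m T g p)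
    (hv : IsHeatSolution m T g p v) {e : OpenPartialHomeomorph M (Coord (m + 1))}
    (he : e ∈ smoothCharts (m + 1) M) {t₀ t₁ : ℝ} (h0 : 0 ≤ t₀) (h1 : t₁ < T) :
    IsLocalSolution e.target (Ioo t₀ t₁) (fun t => laplacianCoeff (metricMatrix (g t) e))
      (fun t => laplacianDrift (metricMatrix (g t) e)) (maxPressure p)
      (fun t => v t ∘ e.symm) := by
  have hJ : Ioo t₀ t₁ ⊆ Ioo 0 T := Ioo_subset_Ioo h0 h1.le
  have hJ' : Ioo t₀ t₁ ⊆ Ico 0 T := hJ.trans Ioo_subset_Ico_self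
  have hsub := prod_mono hJ' (le_refl e.target)
  refine
    { contDiffOn_coeff := fun i j =>
        ((contDiffOn_inv_metricMatrix hflow he i j).mono hsub).of_le (by simp)
      symm := fun t ht y hy i j => ?_
      pos := fun t ht y hy ξ hξ => ?_
      continuousOn_drift := fun k => ?_
      bounded := ?_
      contDiffOn := fun t ht => contDiffOn_comp_symm he two_le_infty (hv.contMDiff t (hJ' ht))
      continuousOn := ?_
      continuousOn_deriv := fun i => (hv.continuousOn_deriv e he i).mono hsub
      continuousOn_deriv_deriv := fun i j => (hv.continuousOn_deriv_deriv e he i j).mono hsub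
      hasDerivAt := fun t ht y hy => ?_ }
  · have := (posDef_metricMatrix (g t) he hy).inv.isHermitian.apply j i
    simpa [laplacianCoeff] using this
  · have := (posDef_metricMatrix (g t) he hy).inv.dotProduct_mulVec_pos hξ
    simp only [dotProduct, Matrix.mulVec, Finset.mul_sum, star_trivial] at this
    refine this.trans_eq (Finset.sum_congr rfl fun i _ => Finset.sum_congr rfl fun j _ => ?_)
    rw [laplacianCoeff]
    ring
  · exact (continuousOn_finsetSum _ fun i _ => continuousOn_finsetSum _ fun j _ =>
      (((contDiffOn_inv_metricMatrix hflow he i j).continuousOn.mono hsub).mul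
        ((continuousOn_christoffel hflow he k i j).mono (prod_mono hJ le_rfl)))).neg
  · obtain ⟨C, hC⟩ := exists_abs_maxPressure_le hflow.smooth_pressure h0 h1
    exact ⟨C, fun t ht => hC t (Ioo_subset_Icc_self ht)⟩
  · refine hv.continuousOn.comp (f := fun z : ℝ × Coord (m + 1) => (z.1, e.symm z.2)) ?_
      fun z hz => ⟨hJ' hz.1, mem_univ _⟩
    exact continuousOn_fst.prodMk (e.continuousOn_symm.comp continuousOn_snd fun z hz => hz.2)
  · have := (hv.heat t (hJ' ht) e he y hy).hasDerivAt (Ico_mem_nhds (hJ ht).1 (hJ ht).2)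
    rw [laplacian_eq_ellipticOp] at this
    exact this

end Flow

end ConformalRicci

theorem corollary1p2 (m : ℕ) (hm : 2 ≤ m)
    (M : Type*) [TopologicalSpace M] [T2Space M] [CompactSpace M] [ConnectedSpace M]
    [ChartedSpace (ConformalRicci.Coord (m + 1)) M] [IsManifold (𝓡 (m + 1)) ∞ M]
    (T : ℝ) (hT : 0 < T)
    (g : ℝ → ConformalRicci.Metric (m + 1) M) (p : ℝ → M → ℝ)
    (hflow : ConformalRicci.IsConformalRicciFlow m T g p)
    (f : ℝ → M → ℝ) (hf : ConformalRicci.IsConjugateHeatPotential m T g p f)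
    (h k : ℝ → ℝ) (hh : ContDiffOn ℝ ∞ h (Ico 0 T)) (hk : ContDiffOn ℝ ∞ k (Ico 0 T))
    (hneg : ∀ t ∈ Ico 0 T, h t < 0)
    (hRic : ConformalRicci.BakryEmeryBound m T g f h k)
    (v : ℝ → M → ℝ) (hv : ConformalRicci.IsHeatSolution m T g p v)
    (a b : ℝ) (ha : 0 < a) (hab : a < b) (hbT : b < T)
    (hvb : ∀ x, v b x = 0) :
    ∀ t ∈ Ico a b, ∀ x, v t x = 0 := by
  obtain ⟨s, ⟨𝒞⟩⟩ := ConformalRicci.exists_bumpCover (m + 1) M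
  intro t ht x
  have h0 : 0 ≤ a / 2 := by linarith
  have h1 : (b + T) / 2 < T := by linarith
  -- The interval from `a / 2` to `(b + T) / 2` is an open neighbourhood of `[a, b]` whose closure
  -- lies in `(0, T)`; this uses `0 < a` and `b < T`.
  refine 𝒞.eq_zero_of_isLocalSolution (J := Ioo (a / 2) ((b + T) / 2))
    (fun i => ConformalRicci.isLocalSolution_of_isHeatSolution hflow hv (𝒞.chart_mem i) h0 h1)
    isOpen_Ioo (Icc_subset_Ioo (by linarith) (by linarith))
    (fun t ht => hv.contMDiff t ⟨h0.trans ht.1.le, ht.2.trans h1⟩) hvb t (Ico_subset_Icc_self ht) x
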